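/- Let $\mathcal X\subset\mathbb R^d$ be compact, $k\ge 2$, $s_1,\dots,s_k\in\mathcal X$. Let $\zeta_1,\zeta_2,\dots$ be the points of a Poisson process on $(0,\infty)$ with intensity $\zeta^{-2}\,d\zeta$ and, independently of them, let $Y_1,Y_2,\dots$ be independent copies of a non-negative process $Y$ on $\mathcal X$ with continuous sample paths, $\mathbb E\,Y(t)=1$ for all $t\in\mathcal X$ and $\mathbb E\sup_{t\in\mathcal X}Y(t)<\infty$. Put $\varphi_i=\zeta_iY_i$ and let $\eta(t)=\max_{i\ge1}\varphi_i(t)$ be the associated simple max-stable process. Let $$p=\mathbb P\{\text{for some }\ell\ge 1:\ \eta(s_j)=\varphi_\ell(s_j),\ j=1,\dots,k\}$$ be the extremal concurrence probability, and let $\pi$ be the extremal hitting scenario, i.e. the random partition of $\{1,\dots,k\}$ in which $j_1,j_2$ lie in the same component if and only if $\arg\max_i\varphi_i(s_{j_1})=\arg\max_i\varphi_i(s_{j_2})$; $|\pi|$ denotes its number of components. Let $X_1,X_2,\dots$ be independent copies of the random vector $(h_1\{\eta(s_1)\},\dots,h_k\{\eta(s_k)\})$, where $h_1,\dots,h_k$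 are strictly increasing functions on $(0,\infty)$ (for instance $h_j(x)=x$). For integers $m,n\ge 1$ let $$p_m=\mathbb P\Big\{\text{for some }\ell\le m:\ \max_{i\le m}X_i(s_j)=X_\ell(s_j),\ j=1,\dots,k\Big\},$$ $$\hat p_m=\frac1{[n/m]}\sum_{b=1}^{[n/m]}\ \max_{\ell=1,\dots,m}1_{\{\max_{i=1,\dots,m}X_{i+(b-1)m}\le X_{\ell+(b-1)m}\}}$$ (componentwise maximum and inequality; $\hat p_m=0$ if $[n/m]=0$). Suppose that $p=0$. Let $r$ be the smallest integer $r\ge1$ such that $c_r:=\mathbb P(|\pi|=r+1)>0$. Then $r$ exists, $1\le r\le k-1$, $0<c_r\le 1-p$, and $r$ and $c_r$ are the constants for which $p_m-p\sim c_r/m^r$ as $m\to\infty$. Moreover, let $m=m(n)$ be positive integers such that $n/m(n)\to\infty$ and $m(n)/n^{1/(r+1)}\to\lambda\in(0,\infty]$ as $n\to\infty$. (i) If $\lambda<\infty$, then $(n/m)\,\hat p_m\to\mathrm{Poisson}(c_r/\lambda^{r+1})$ in distribution as $n\to\infty$. (ii) If $\lambda=\infty$, then $\mathbb P(\hat p_m=0)\to1$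 as $n\to\infty$, and $a_n\hat p_m\to0$ in probability for every sequence $a_n>0$. -/

import Mathlib

open MeasureTheory ProbabilityTheory Filter Topology
open scoped ENNReal NNReal

namespace Concurrence

noncomputable section

/-! ### Poisson point processes -/

/-- Number of indices `i` for which the random point `ξ i` lies in `A`. -/
def pointCount {Ω E : Type*} (ξ : ℕ → Ω → E) (A : Set E) (ω : Ω) : ℕ∞ :=
  {i : ℕ | ξ i ω ∈ A}.encard

/-- The random points `ξ 0, ξ 1, …` (an enumeration in any order) are the points of a Poisson
process with intensity measure `μ`: counts of points are Poisson distributed with parameter `μ A`,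
and counts in pairwise disjoint sets are independent. -/
structure IsPoissonProcess {Ω E : Type*} [MeasurableSpace Ω] [MeasurableSpace E]
    (P : Measure Ω) (ξ : ℕ → Ω → E) (μ : Measure E) : Prop where
  measurable : ∀ i, Measurable (ξ i)
  count_law : ∀ A : Set E, MeasurableSet A → μ A ≠ ∞ →
    P.map (pointCount ξ A) = (poissonMeasure (μ A).toNNReal).map (fun q : ℕ => (q : ℕ∞))
  count_top : ∀ A : Set E, MeasurableSet A → μ A = ∞ → ∀ᵐ ω ∂P, pointCount ξ A ω = ⊤
  indep : ∀ (q : ℕ) (A : Fin q → Set E), (∀ a, MeasurableSet (A a)) →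
    Pairwise (fun a b => Disjoint (A a) (A b)) →
    iIndepFun (fun a => pointCount ξ (A a)) P

/-- The measure `ζ⁻² dζ` on `(0, ∞)`, seen as a measure on `ℝ`. -/
def frechetIntensity : Measure ℝ :=
  (volume.restrict (Set.Ioi (0 : ℝ))).withDensity (fun z => ENNReal.ofReal ((z ^ 2)⁻¹))

/-! ### Simple max-stable processes -/

/-- The ingredients of the spectral representation `η = max_i ζ_i Y_i` of a simple max-stable
process on `T`: the `ζ_i` are the points of a Poisson process on `(0, ∞)` with intensity
`ζ⁻² dζ`; independently of these, the `Y_i` are independent copies of a non-negative process with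
continuous paths such that `E Y(t) = 1` for all `t` and `E sup_t Y(t) < ∞`. -/
structure IsSpectralSystem {Ω T : Type*} [MeasurableSpace Ω] [TopologicalSpace T]
    (P : Measure Ω) (ζ : ℕ → Ω → ℝ) (Y : ℕ → Ω → T → ℝ) : Prop where
  poisson : IsPoissonProcess P ζ frechetIntensity
  measurable : ∀ i, Measurable (Y i)
  nonneg : ∀ i ω t, 0 ≤ Y i ω t
  continuous : ∀ i ω, Continuous (Y i ω)
  identDistrib : ∀ i, IdentDistrib (Y i) (Y 0) P P
  indep : iIndepFun Y P
  indep_poisson : IndepFun (fun ω i => ζ i ω) (fun ω i => Y i ω) P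
  mean_eq_one : ∀ t, ∫⁻ ω, ENNReal.ofReal (Y 0 ω t) ∂P = 1
  mean_sup_lt_top : ∫⁻ ω, ⨆ t, ENNReal.ofReal (Y 0 ω t) ∂P < ∞

section

variable {Ω T : Type*} (ζ : ℕ → Ω → ℝ) (Y : ℕ → Ω → T → ℝ)

/-- The random function `φ_i = ζ_i Y_i`. -/
def spectralFun (i : ℕ) (ω : Ω) (t : T) : ℝ := ζ i ω * Y i ω t

/-- The simple max-stable process `η(t) = max_i ζ_i Y_i(t)`. -/
def maxStable (ω : Ω) (t : T) : ℝ := ⨆ i : ℕ, spectralFun ζ Y i ω t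

variable {k : ℕ} (s : Fin k → T)

/-- The event of extremal concurrence at `s_1, …, s_k`. -/
def extremalConcurrence : Set Ω :=
  {ω | ∃ l : ℕ, ∀ j, maxStable ζ Y ω (s j) = spectralFun ζ Y l ω (s j)}

/-- The set of indices `i` at which `φ_i(t)` is maximal (almost surely a singleton). -/
def argmaxSet (ω : Ω) (t : T) : Set ℕ :=
  {i | ∀ l, spectralFun ζ Y l ω t ≤ spectralFun ζ Y i ω t}

/-- The extremal hitting scenario: the random partition of the `k` indices, given as an
equivalence relation, that puts two indices in the same component if and only if the maxima at the
two sites are attained by the same `φ_i`. -/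
def hittingScenario (ω : Ω) : Setoid (Fin k) :=
  Setoid.ker (fun j => argmaxSet ζ Y ω (s j))

/-- The number of components of the extremal hitting scenario. -/
def numComponents (ω : Ω) : ℕ := Nat.card (Quotient (hittingScenario ζ Y s ω))

variable [MeasurableSpace Ω] (P : Measure Ω)

/-- The extremal concurrence probability `p(s_1, …, s_k)`. -/
def extremalConcurrenceProb : ℝ := P.real (extremalConcurrence ζ Y s)

/-- The probability that the extremal hitting scenario has exactly `q` components. -/
def hittingProb (q : ℕ) : ℝ := P.real {ω | numComponents ζ Y s ω = q}

/-- The smallest integer `r ≥ 1` such that the extremal hitting scenario has `r + 1` components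
with positive probability. -/
def biasExponent : ℕ := sInf {q : ℕ | 1 ≤ q ∧ 0 < hittingProb ζ Y s P (q + 1)}

/-- The probability `c_r` that the extremal hitting scenario has `r + 1` components, for `r` the
bias exponent. -/
def biasConst : ℝ := hittingProb ζ Y s P (biasExponent ζ Y s P + 1)

end

/-! ### Sample concurrence -/

section

variable {Ω : Type*} {k : ℕ} (X : ℕ → Ω → Fin k → ℝ)

/-- The sample concurrence probability `p_m`: one of the first `m` vectors attains all the
componentwise maxima of the first `m` vectors. -/
def sampleConcurrenceProb [MeasurableSpace Ω] (P : Measure Ω) (m : ℕ) : ℝ :=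
  P.real {ω | ∃ l : Fin m, ∀ j, (⨆ i : Fin m, X i ω j) = X l ω j}

open Classical in
/-- Indicator of sample concurrence in the block of the `m` vectors with (zero-based) indices
`b m, …, b m + m - 1`; the inequality is componentwise. -/
def blockIndicator (m b : ℕ) (ω : Ω) : ℝ :=
  if ∃ l : Fin m, ∀ i : Fin m, X (b * m + i) ω ≤ X (b * m + l) ω then 1 else 0

/-- The estimator of the concurrence probability from the first `n` vectors with blocks of size
`m`: the mean of the indicators over the `⌊n / m⌋` blocks. -/
def estimator (n m : ℕ) (ω : Ω) : ℝ :=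
  (1 / ((n / m : ℕ) : ℝ)) * ∑ b ∈ Finset.range (n / m), blockIndicator X m b ω

end

end

end Concurrence

open Concurrence

namespace Concurrence

/-! ### Probability generating functionals of Poisson processes -/

/-! Everything rests on the exact identity p_m = E m^(1 - |π|) = ∑_q P(|π| = q + 1) m^(-q), proved
in `pi_real_concurrentSet` by thinning. Give every φ_i an independent label, uniform on `Fin m`, and
let `labelMax` be the maximum of the functions carrying a given label. The labels split the Poisson
process into m independent parts of intensity ζ⁻² dζ / m, and by the scaling of this intensity m
times the labelled maxima are m independent copies of η at the sites (`map_labelMax`). So the m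
sample vectors may be taken to be these labelled maxima. Almost surely each site has exactly one
maximizing φ_i (`ae_exists_argmax`), and distinct labels never tie. Hence one copy dominates the
others exactly when all maximizing functions carry the same label. Given the φ_i, these are |π|
distinct functions, so this has probability m · m^(-|π|).

The independence in the thinning step is read off from joint distribution functions. They are void
probabilities of labelled exceedances (`prod_labelMeasure_forall_le`), and these are computed from
the probability generating functional of a marked Poisson process (`tendsto_integral_prod_marked`).

If p = 0, the term q = 0 vanishes; the first nonzero term has q = r, so m^r p_m → c_r. The sum of
the block indicators is binomial with parameters [n/m] and p_m, and (n/m) p_m = (m^r p_m)(n /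
m^(r+1)) tends to c_r / λ^(r+1). The law of rare events, proved with characteristic functions, gives
the Poisson limit (`tendstoInDistribution_estimator`). When λ = ∞ the limit is 0 and a union bound
over blocks suffices. -/

open Classical in
theorem eventually_prod_ite_eq_pow_ncard {E : Type*} (x : ℕ → E) (A : Set E) (v : ℝ)
    (hfin : {i | x i ∈ A}.Finite) :
    ∀ᶠ n in atTop, ∏ i ∈ Finset.range n, (if x i ∈ A then v else 1) =
      v ^ {i | x i ∈ A}.ncard := by
  obtain ⟨N, hN⟩ := hfin.bddAbove
  filter_upwards [eventually_gt_atTop N] with n hn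
  rw [Finset.prod_ite, Finset.prod_const, Finset.prod_const_one, mul_one]
  congr 1
  rw [← Set.ncard_coe_finset]
  congr 1
  ext i
  simp only [Finset.coe_filter, Finset.mem_range, Set.mem_ofPred_eq, and_iff_right_iff_imp]
  exact fun hi => lt_of_le_of_lt (hN hi) hn

section PoissonFunctional

variable {Ω E : Type*} [MeasurableSpace Ω] [MeasurableSpace E] {P : Measure Ω}
  {ξ : ℕ → Ω → E} {μ : Measure E}

/-- The pushforward along a map that is not a.e. measurable is 0 by convention, so having a Poisson
law already forces measurability. -/
theorem aemeasurable_pointCount [IsProbabilityMeasure P] (hξ : IsPoissonProcess P ξ μ) {A : Set E}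
    (hA : MeasurableSet A) (hμ : μ A ≠ ∞) : AEMeasurable (pointCount ξ A) P := by
  apply aemeasurable_of_map_neZero
  rw [hξ.count_law A hA hμ]
  have : IsProbabilityMeasure
      ((poissonMeasure (μ A).toNNReal).map (fun q : ℕ => (q : ℕ∞))) :=
    Measure.isProbabilityMeasure_map (by fun_prop)
  infer_instance

/-- This is the Poisson generating function. The value `⊤`, which `toNat` sends to 0, has no mass.
-/
theorem integral_pow_pointCount [IsProbabilityMeasure P] (hξ : IsPoissonProcess P ξ μ) {A : Set E}
    (hA : MeasurableSet A) (hμ : μ A ≠ ∞) (v : ℝ) :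
    ∫ ω, v ^ (pointCount ξ A ω).toNat ∂P = Real.exp (-((1 - v) * (μ A).toReal)) := by
  have h1 : ∫ ω, v ^ (pointCount ξ A ω).toNat ∂P
      = ∫ q : ℕ∞, v ^ q.toNat ∂(P.map (pointCount ξ A)) :=
    (integral_map (aemeasurable_pointCount hξ hA hμ)
      (Measurable.of_discrete (f := fun q : ℕ∞ => v ^ q.toNat)).aestronglyMeasurable).symm
  rw [h1, hξ.count_law A hA hμ, integral_map (by fun_prop)
      (Measurable.of_discrete (f := fun q : ℕ∞ => v ^ q.toNat)).aestronglyMeasurable,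
    integral_poissonMeasure]
  simp only [ENat.toNat_natCast, ENNReal.coe_toNNReal_eq_toReal, smul_eq_mul]
  set L := (μ A).toReal
  have h2 := (NormedSpace.expSeries_div_hasSum_exp (L * v)).mul_left (Real.exp (-L))
  rw [← Real.exp_eq_exp_ℝ, ← Real.exp_add] at h2
  have h3 : -L + L * v = -((1 - v) * L) := by ring
  rw [h3] at h2
  rw [← h2.tsum_eq]
  congr 1
  ext n
  rw [mul_pow]
  ring

theorem prod_range_mem_Icc {f : ℕ → ℝ} (h0 : ∀ i, 0 ≤ f i) (h1 : ∀ i, f i ≤ 1) (n : ℕ) :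
    ∏ i ∈ Finset.range n, f i ∈ Set.Icc (0 : ℝ) 1 :=
  ⟨Finset.prod_nonneg fun i _ => h0 i, Finset.prod_le_one (fun i _ => h0 i) fun i _ => h1 i⟩

theorem norm_prod_range_le_one {f : ℕ → ℝ} (h0 : ∀ i, 0 ≤ f i) (h1 : ∀ i, f i ≤ 1) (n : ℕ) :
    ‖∏ i ∈ Finset.range n, f i‖ ≤ 1 := by
  obtain ⟨a, b⟩ := prod_range_mem_Icc h0 h1 n
  rwa [Real.norm_of_nonneg a]

/-- Each factor is a product over the levels v of `g`, so the whole product becomes ∏_v (1 -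
v)^(N_v) with N_v the number of points at level v. These counts are independent, Poisson and a.s.
finite; hence the partial products are eventually constant and the expectation factorizes. -/
theorem tendsto_integral_prod_simpleFunc [IsProbabilityMeasure P] (hξ : IsPoissonProcess P ξ μ)
    (g : SimpleFunc E ℝ≥0∞) (hg : ∀ z, g z ≤ 1) (hI : ∫⁻ z, g z ∂μ ≠ ∞) :
    Tendsto (fun n => ∫ ω, ∏ i ∈ Finset.range n, (1 - (g (ξ i ω)).toReal) ∂P) atTop
      (𝓝 (Real.exp (-(∫⁻ z, g z ∂μ).toReal))) := by
  classical
  -- Level 0 contributes only factors 1, and its level set may have infinite measure.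
  set S := g.range.erase 0 with hS
  have hint : ∫⁻ z, g z ∂μ = ∑ v ∈ S, v * μ (g ⁻¹' {v}) := by
    rw [SimpleFunc.lintegral_eq_lintegral, SimpleFunc.lintegral, hS]
    by_cases h0 : (0 : ℝ≥0∞) ∈ g.range
    · rw [← Finset.add_sum_erase _ _ h0, zero_mul, zero_add]
    · rw [Finset.erase_eq_of_notMem h0]
  have hterm : ∀ v ∈ S, v * μ (g ⁻¹' {v}) ≠ ∞ := fun v hv =>
    ne_top_of_le_ne_top (hint ▸ hI) (Finset.single_le_sum
      (f := fun v => v * μ (g ⁻¹' {v})) (fun _ _ => zero_le) hv)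
  have hμA : ∀ v ∈ S, μ (g ⁻¹' {v}) ≠ ∞ := by
    intro v hv h
    have := hterm v hv
    rw [h, ENNReal.mul_top (Finset.ne_of_mem_erase hv)] at this
    exact this rfl
  have hmeas : ∀ v, MeasurableSet (g ⁻¹' {v}) := fun v => g.measurableSet_preimage _
  have hfac : ∀ z, 1 - (g z).toReal
      = ∏ v ∈ S, if z ∈ g ⁻¹' {v} then 1 - v.toReal else 1 := by
    intro z
    simp only [Set.mem_preimage, Set.mem_singleton_iff]
    rw [Finset.prod_ite_eq]
    split_ifs with h
    · rfl
    · have : g z = 0 := by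
        by_contra h0
        exact h (Finset.mem_erase.2 ⟨h0, g.mem_range_self z⟩)
      simp [this]
  have hfin : ∀ᵐ ω ∂P, ∀ v ∈ S, pointCount ξ (g ⁻¹' {v}) ω ≠ ⊤ := by
    refine (Finset.eventually_all S).2 fun v hv => ?_
    have hm := aemeasurable_pointCount hξ (hmeas v) (hμA v hv)
    refine ae_of_ae_map (p := fun q => q ≠ ⊤) hm ?_
    rw [hξ.count_law _ (hmeas v) (hμA v hv), ae_map_iff (by fun_prop) (by measurability)]
    exact ae_of_all _ fun q => ENat.natCast_ne_top q
  have hlim : Tendsto (fun n => ∫ ω, ∏ i ∈ Finset.range n, (1 - (g (ξ i ω)).toReal) ∂P) atTop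
      (𝓝 (∫ ω, ∏ v ∈ S, (1 - v.toReal) ^ (pointCount ξ (g ⁻¹' {v}) ω).toNat ∂P)) := by
    refine tendsto_integral_of_dominated_convergence (fun _ => 1) ?_ (integrable_const _) ?_ ?_
    · intro n
      refine Measurable.aestronglyMeasurable ?_
      refine Finset.measurable_prod _ fun i _ => ?_
      exact measurable_const.sub ((g.measurable.comp (hξ.measurable i)).ennreal_toReal)
    · intro n
      refine ae_of_all _ fun ω => norm_prod_range_le_one (fun i => ?_) (fun i => ?_) n
      · have := ENNReal.toReal_mono ENNReal.one_ne_top (hg (ξ i ω))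
        simp only [ENNReal.toReal_one] at this
        linarith
      · linarith [ENNReal.toReal_nonneg (a := g (ξ i ω))]
    · filter_upwards [hfin] with ω hω
      refine tendsto_const_nhds.congr' ?_
      have : ∀ᶠ n in atTop, ∀ v ∈ S, ∏ i ∈ Finset.range n,
          (if ξ i ω ∈ g ⁻¹' {v} then 1 - v.toReal else 1)
          = (1 - v.toReal) ^ {i | ξ i ω ∈ g ⁻¹' {v}}.ncard := by
        rw [Finset.eventually_all]
        intro v hv
        refine eventually_prod_ite_eq_pow_ncard _ _ _ ?_
        exact Set.encard_ne_top_iff.1 (hω v hv)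
      filter_upwards [this] with n hn
      simp_rw [hfac]
      rw [Finset.prod_comm]
      exact Finset.prod_congr rfl fun v hv => (hn v hv).symm
  have hval : ∫ ω, ∏ v ∈ S, (1 - v.toReal) ^ (pointCount ξ (g ⁻¹' {v}) ω).toNat ∂P
      = Real.exp (-(∫⁻ z, g z ∂μ).toReal) := by
    have hind : iIndepFun (fun v : S => pointCount ξ (g ⁻¹' {v.1})) P := by
      let e := S.equivFin
      have h1 := hξ.indep S.card (fun a => g ⁻¹' {(e.symm a).1}) (fun a => hmeas _) (by
        intro a b hab
        refine Disjoint.preimage _ ?_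
        rw [Set.disjoint_singleton]
        intro h
        exact hab (e.symm.injective (Subtype.ext h)))
      have h2 := h1.precomp e.injective
      simpa using h2
    have h3 := hind.integral_fun_prod_comp (𝕜 := ℝ)
      (f := fun (v : S) (q : ℕ∞) => (1 - v.1.toReal) ^ q.toNat)
      (fun v => aemeasurable_pointCount hξ (hmeas v.1) (hμA v.1 v.2))
      (fun v => Measurable.of_discrete.aestronglyMeasurable)
    rw [hint, ENNReal.toReal_sum hterm, ← Finset.sum_neg_distrib, Real.exp_sum,
      ← Finset.prod_coe_sort S]
    simp_rw [← Finset.prod_coe_sort S]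
    rw [h3]
    refine Finset.prod_congr rfl fun v _ => ?_
    rw [integral_pow_pointCount hξ (hmeas v.1) (hμA v.1 v.2), ENNReal.toReal_mul]
    congr 2
    ring
  rwa [hval] at hlim

/-- Approximate 1 - f from below by simple functions, so that f ≤ F_N. Expected partial products
decrease in n. For fixed n they therefore lie above the limit for F_N, and N → ∞ gives the lower
bound. The upper bound uses f ≤ F_N for one large N, so the limits in n and N are never
interchanged. -/
theorem tendsto_integral_prod [IsProbabilityMeasure P] (hξ : IsPoissonProcess P ξ μ)
    {f : E → ℝ} (hf : Measurable f) (h0 : ∀ z, 0 ≤ f z) (h1 : ∀ z, f z ≤ 1)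
    (hI : ∫⁻ z, ENNReal.ofReal (1 - f z) ∂μ ≠ ∞) :
    Tendsto (fun n => ∫ ω, ∏ i ∈ Finset.range n, f (ξ i ω) ∂P) atTop
      (𝓝 (Real.exp (-(∫⁻ z, ENNReal.ofReal (1 - f z) ∂μ).toReal))) := by
  set G : E → ℝ≥0∞ := fun z => ENNReal.ofReal (1 - f z) with hG
  have hGm : Measurable G := by fun_prop
  have hG1 : ∀ z, G z ≤ 1 := fun z => by
    rw [hG, ENNReal.ofReal_le_one]; linarith [h0 z]
  set g : ℕ → SimpleFunc E ℝ≥0∞ := SimpleFunc.eapprox G with hg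
  have hgG : ∀ N z, g N z ≤ G z := fun N z => by
    rw [← SimpleFunc.iSup_eapprox_apply hGm z]
    exact le_iSup (fun n => SimpleFunc.eapprox G n z) N
  have hg1 : ∀ N z, g N z ≤ 1 := fun N z => (hgG N z).trans (hG1 z)
  have hgI : ∀ N, ∫⁻ z, g N z ∂μ ≤ ∫⁻ z, G z ∂μ := fun N => lintegral_mono (hgG N)
  have hgI' : ∀ N, ∫⁻ z, g N z ∂μ ≠ ∞ := fun N => ne_top_of_le_ne_top hI (hgI N)
  set F : ℕ → E → ℝ := fun N z => 1 - (g N z).toReal with hF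
  have hFm : ∀ N, Measurable (F N) := fun N =>
    measurable_const.sub (g N).measurable.ennreal_toReal
  have hF0 : ∀ N z, 0 ≤ F N z := fun N z => by
    have := ENNReal.toReal_mono ENNReal.one_ne_top (hg1 N z)
    simp only [ENNReal.toReal_one] at this
    simp only [hF]; linarith
  have hF1 : ∀ N z, F N z ≤ 1 := fun N z => by
    simp only [hF]; linarith [ENNReal.toReal_nonneg (a := g N z)]
  have hfF : ∀ N z, f z ≤ F N z := fun N z => by
    have := ENNReal.toReal_mono (ne_top_of_le_ne_top ENNReal.one_ne_top (hG1 z)) (hgG N z)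
    rw [hG, ENNReal.toReal_ofReal (by linarith [h1 z])] at this
    simp only [hF]; linarith
  have hFlim : ∀ z, Tendsto (fun N => F N z) atTop (𝓝 (f z)) := fun z => by
    have h2 := (ENNReal.tendsto_toReal (ne_top_of_le_ne_top ENNReal.one_ne_top (hG1 z))).comp
      (SimpleFunc.tendsto_eapprox hGm z)
    have h3 : (G z).toReal = 1 - f z := ENNReal.toReal_ofReal (by linarith [h1 z])
    rw [h3] at h2
    have h4 := h2.const_sub 1
    simpa [hF] using h4
  have hmeas : ∀ (u : E → ℝ), Measurable u → ∀ n,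
      Measurable (fun ω => ∏ i ∈ Finset.range n, u (ξ i ω)) := fun u hu n =>
    Finset.measurable_prod _ fun i _ => hu.comp (hξ.measurable i)
  have hintg : ∀ (u : E → ℝ), Measurable u → (∀ z, 0 ≤ u z) → (∀ z, u z ≤ 1) → ∀ n,
      Integrable (fun ω => ∏ i ∈ Finset.range n, u (ξ i ω)) P := fun u hu hu0 hu1 n =>
    (integrable_const (1 : ℝ)).mono' (hmeas u hu n).aestronglyMeasurable
      (ae_of_all _ fun ω => norm_prod_range_le_one (fun i => hu0 _) (fun i => hu1 _) n)
  have hanti : ∀ (u : E → ℝ), Measurable u → (∀ z, 0 ≤ u z) → (∀ z, u z ≤ 1) →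
      Antitone (fun n => ∫ ω, ∏ i ∈ Finset.range n, u (ξ i ω) ∂P) := by
    intro u hu hu0 hu1
    refine antitone_nat_of_succ_le fun n => ?_
    refine integral_mono (hintg u hu hu0 hu1 _) (hintg u hu hu0 hu1 _) fun ω => ?_
    simp only [Finset.prod_range_succ]
    exact mul_le_of_le_one_right (Finset.prod_nonneg fun i _ => hu0 _) (hu1 _)
  have hsimp : ∀ N, Tendsto (fun n => ∫ ω, ∏ i ∈ Finset.range n, F N (ξ i ω) ∂P) atTop
      (𝓝 (Real.exp (-(∫⁻ z, g N z ∂μ).toReal))) := fun N =>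
    tendsto_integral_prod_simpleFunc hξ (g N) (hg1 N) (hgI' N)
  have hlow : ∀ n, Real.exp (-(∫⁻ z, G z ∂μ).toReal)
      ≤ ∫ ω, ∏ i ∈ Finset.range n, f (ξ i ω) ∂P := by
    intro n
    have hl : Tendsto (fun N => ∫ ω, ∏ i ∈ Finset.range n, F N (ξ i ω) ∂P) atTop
        (𝓝 (∫ ω, ∏ i ∈ Finset.range n, f (ξ i ω) ∂P)) := by
      refine tendsto_integral_of_dominated_convergence (fun _ => 1) ?_ (integrable_const _) ?_ ?_
      · exact fun N => (hmeas _ (hFm N) n).aestronglyMeasurable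
      · exact fun N => ae_of_all _ fun ω =>
          norm_prod_range_le_one (fun i => hF0 N _) (fun i => hF1 N _) n
      · exact ae_of_all _ fun ω => tendsto_finsetProd _ fun i _ => hFlim _
    refine ge_of_tendsto' hl fun N => ?_
    refine le_trans ?_ ((hanti _ (hFm N) (hF0 N) (hF1 N)).le_of_tendsto (hsimp N) n)
    rw [Real.exp_le_exp, neg_le_neg_iff]
    exact ENNReal.toReal_mono hI (hgI N)
  have hexp : Tendsto (fun N => Real.exp (-(∫⁻ z, g N z ∂μ).toReal)) atTop
      (𝓝 (Real.exp (-(∫⁻ z, G z ∂μ).toReal))) := by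
    refine (Real.continuous_exp.tendsto _).comp (Tendsto.neg ?_)
    refine (ENNReal.tendsto_toReal hI).comp ?_
    exact lintegral_tendsto_of_tendsto_of_monotone (fun N => (g N).measurable.aemeasurable)
      (ae_of_all _ fun z i j hij => SimpleFunc.monotone_eapprox G hij z)
      (ae_of_all _ fun z => SimpleFunc.tendsto_eapprox hGm z)
  refine tendsto_order.2 ⟨fun a ha => Eventually.of_forall fun n => ha.trans_le (hlow n), ?_⟩
  intro a ha
  obtain ⟨N, hN⟩ := ((tendsto_order.1 hexp).2 a ha).exists
  filter_upwards [(tendsto_order.1 (hsimp N)).2 a hN] with n hn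
  refine lt_of_le_of_lt ?_ hn
  refine integral_mono (hintg f hf h0 h1 _) (hintg _ (hFm N) (hF0 N) (hF1 N) _) fun ω => ?_
  exact Finset.prod_le_prod (fun i _ => h0 _) fun i _ => hfF N _

/-- The marked version of `tendsto_integral_prod`: the points carry independent identically
distributed marks that are independent of the process. -/
theorem tendsto_integral_prod_marked [IsProbabilityMeasure P] [SFinite μ] {W : Type*}
    [MeasurableSpace W] {y : ℕ → Ω → W}
    (hξ : IsPoissonProcess P ξ μ) (hy : ∀ i, Measurable (y i))
    (hid : ∀ i, IdentDistrib (y i) (y 0) P P) (hind : iIndepFun y P)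
    (hindξ : IndepFun (fun ω i => ξ i ω) (fun ω i => y i ω) P)
    {u : E → W → ℝ} (hu : Measurable (Function.uncurry u)) (h0 : ∀ z w, 0 ≤ u z w)
    (h1 : ∀ z w, u z w ≤ 1)
    (hI : ∫⁻ ω, ∫⁻ z, ENNReal.ofReal (1 - u z (y 0 ω)) ∂μ ∂P ≠ ∞) :
    Tendsto (fun n => ∫ ω, ∏ i ∈ Finset.range n, u (ξ i ω) (y i ω) ∂P) atTop
      (𝓝 (Real.exp (-(∫⁻ ω, ∫⁻ z, ENNReal.ofReal (1 - u z (y 0 ω)) ∂μ ∂P).toReal))) := by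
  set f : E → ℝ := fun z => ∫ ω, u z (y 0 ω) ∂P with hf
  have hu1 : ∀ z, Measurable (u z) := fun z => hu.of_uncurry_left
  have hui : ∀ z, Integrable (fun ω => u z (y 0 ω)) P := fun z =>
    (integrable_const (1 : ℝ)).mono' ((hu1 z).comp (hy 0)).aestronglyMeasurable
      (ae_of_all _ fun ω => by rw [Real.norm_of_nonneg (h0 _ _)]; exact h1 _ _)
  have huy : Measurable (fun p : E × Ω => u p.1 (y 0 p.2)) :=
    hu.comp (measurable_fst.prodMk ((hy 0).comp measurable_snd))
  have hfm : Measurable f := (huy.stronglyMeasurable.integral_prod_right (ν := P)).measurable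
  have hf0 : ∀ z, 0 ≤ f z := fun z => integral_nonneg fun ω => h0 _ _
  have hf1 : ∀ z, f z ≤ 1 := fun z => by
    have := integral_mono (hui z) (integrable_const (1 : ℝ)) fun ω => h1 z (y 0 ω)
    simpa using this
  have hswap : ∫⁻ z, ENNReal.ofReal (1 - f z) ∂μ
      = ∫⁻ ω, ∫⁻ z, ENNReal.ofReal (1 - u z (y 0 ω)) ∂μ ∂P := by
    rw [lintegral_lintegral_swap]
    · refine lintegral_congr fun z => ?_
      have h3 : ∫ ω, (1 - u z (y 0 ω)) ∂P = 1 - f z := by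
        rw [integral_sub (integrable_const _) (hui z)]
        simp [hf]
      rw [← h3]
      exact ofReal_integral_eq_lintegral_ofReal ((integrable_const _).sub (hui z))
        (ae_of_all _ fun ω => sub_nonneg.2 (h1 _ _))
    · exact ((measurable_const.sub huy).ennreal_ofReal.comp measurable_swap).aemeasurable
  -- Given the points, the marks integrate out factor by factor, which replaces `u` by its mean `f`
  -- over a mark and leaves an unmarked functional.
  have hprod : ∀ n, ∫ ω, ∏ i ∈ Finset.range n, u (ξ i ω) (y i ω) ∂P
      = ∫ ω, ∏ i ∈ Finset.range n, f (ξ i ω) ∂P := by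
    intro n
    have hξm : Measurable (fun ω i => ξ i ω) := measurable_pi_lambda _ hξ.measurable
    have hym : Measurable (fun ω i => y i ω) := measurable_pi_lambda _ hy
    have hmap := (indepFun_iff_map_prod_eq_prod_map_map hξm.aemeasurable hym.aemeasurable).1 hindξ
    have hPhi : Measurable (fun p : (ℕ → E) × (ℕ → W) =>
        ∏ i ∈ Finset.range n, u (p.1 i) (p.2 i)) :=
      Finset.measurable_prod _ fun i _ => by
        have h2 : Measurable (fun p : (ℕ → E) × (ℕ → W) => (p.1 i, p.2 i)) := by fun_prop
        exact hu.comp h2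
    have : IsProbabilityMeasure (P.map fun ω i => ξ i ω) :=
      Measure.isProbabilityMeasure_map hξm.aemeasurable
    have : IsProbabilityMeasure (P.map fun ω i => y i ω) :=
      Measure.isProbabilityMeasure_map hym.aemeasurable
    have e1 : ∫ ω, ∏ i ∈ Finset.range n, u (ξ i ω) (y i ω) ∂P
        = ∫ p, ∏ i ∈ Finset.range n, u (p.1 i) (p.2 i)
          ∂((P.map fun ω i => ξ i ω).prod (P.map fun ω i => y i ω)) := by
      rw [← hmap, integral_map (hξm.prodMk hym).aemeasurable hPhi.aestronglyMeasurable]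
    rw [e1, integral_prod, integral_map hξm.aemeasurable]
    · refine integral_congr_ae (ae_of_all _ fun ω => ?_)
      simp only
      rw [integral_map hym.aemeasurable]
      · have h3 := (hind.precomp (Fin.val_injective (n := n))).integral_fun_prod_comp (𝕜 := ℝ)
          (f := fun (i : Fin n) (w : W) => u (ξ i ω) w)
          (fun i => (hy _).aemeasurable) (fun i => (hu1 _).aestronglyMeasurable)
        simp_rw [Finset.prod_range]
        rw [h3]
        refine Finset.prod_congr rfl fun i _ => ?_
        exact ((hid i).comp (hu1 (ξ i ω))).integral_eq
      · exact (hPhi.comp measurable_prodMk_left).aestronglyMeasurable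
    · exact (hPhi.stronglyMeasurable.integral_prod_right').aestronglyMeasurable
    · refine (integrable_const (1 : ℝ)).mono' hPhi.aestronglyMeasurable
        (ae_of_all _ fun p => norm_prod_range_le_one (fun i => h0 _ _) (fun i => h1 _ _) n)
  simp_rw [hprod, ← hswap]
  exact tendsto_integral_prod hξ hfm hf0 hf1 (hswap ▸ hI)

end PoissonFunctional

/-! ### The Fréchet intensity -/

theorem frechetIntensity_Ioi {c : ℝ} (hc : 0 < c) :
    frechetIntensity (Set.Ioi c) = ENNReal.ofReal c⁻¹ := by
  rw [frechetIntensity, withDensity_apply _ measurableSet_Ioi,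
    Measure.restrict_restrict measurableSet_Ioi,
    Set.inter_eq_left.2 (Set.Ioi_subset_Ioi hc.le)]
  have h1 : ∀ z ∈ Set.Ioi c, (z ^ 2)⁻¹ = z ^ (-2 : ℝ) := fun z hz => by
    have hz' : 0 < z := hc.trans hz
    rw [Real.rpow_neg hz'.le]
    norm_num
  rw [setLIntegral_congr_fun measurableSet_Ioi
      (g := fun z => ENNReal.ofReal (z ^ (-2 : ℝ))) (fun z hz => by simp only [h1 z hz]),
    ← ofReal_integral_eq_lintegral_ofReal (integrableOn_Ioi_rpow_of_lt (by norm_num) hc),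
    integral_Ioi_rpow_of_lt (by norm_num) hc]
  · congr 1
    norm_num
    rw [Real.rpow_neg_one]
  · filter_upwards [ae_restrict_mem measurableSet_Ioi] with z hz
    exact Real.rpow_nonneg (hc.trans hz).le _

theorem frechetIntensity_Iic_zero : frechetIntensity (Set.Iic 0) = 0 := by
  rw [frechetIntensity, withDensity_apply _ measurableSet_Iic,
    Measure.restrict_restrict measurableSet_Iic, Set.Iic_inter_Ioi, Set.Ioc_self,
    Measure.restrict_empty, lintegral_zero_measure]

instance : SFinite frechetIntensity := by
  unfold frechetIntensity
  infer_instance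

/-- The exceedance mass is linear in `g`; this is why the exponents below are plain expectations of
functionals of Y. -/
theorem frechetIntensity_one_lt_mul {g : ℝ} (hg : 0 ≤ g) :
    frechetIntensity {z | 1 < z * g} = ENNReal.ofReal g := by
  rcases hg.eq_or_lt with rfl | hg
  · simp [not_lt.2 (zero_le_one' ℝ)]
  · have : {z | 1 < z * g} = Set.Ioi g⁻¹ := by
      ext z
      simp only [Set.mem_ofPred_eq, Set.mem_Ioi]
      rw [inv_lt_iff_one_lt_mul₀ hg]
    rw [this, frechetIntensity_Ioi (inv_pos.2 hg), inv_inv]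

/-! ### Exceedance functionals of spectral systems -/

section Spectral

variable {Ω T : Type*} [MeasurableSpace Ω] [TopologicalSpace T] {P : Measure Ω}
  {ζ : ℕ → Ω → ℝ} {Y : ℕ → Ω → T → ℝ}

-- θ a plays the role of the probability of label a. The sum in each factor is then the conditional
-- probability, given the point, that its label is one whose condition it violates; ∑ θ ≤ 1 keeps
-- the factors in [0, 1].
open Classical in
theorem IsSpectralSystem.tendsto_integral_prod_exceedance [IsProbabilityMeasure P]
    (hη : IsSpectralSystem P ζ Y)
    {ι : Type*} [Fintype ι] {θ : ι → ℝ} (hθ : ∀ a, 0 ≤ θ a) (hθ1 : ∑ a, θ a ≤ 1)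
    {G : ι → (T → ℝ) → ℝ} (hG : ∀ a, Measurable (G a)) (hG0 : ∀ a ω, 0 ≤ G a (Y 0 ω))
    (hGi : ∀ a, Integrable (fun ω => G a (Y 0 ω)) P) :
    Tendsto (fun n => ∫ ω, ∏ i ∈ Finset.range n,
        (1 - ∑ a, if 1 < ζ i ω * G a (Y i ω) then θ a else 0) ∂P) atTop
      (𝓝 (Real.exp (-∑ a, θ a * ∫ ω, G a (Y 0 ω) ∂P))) := by
  set u : ℝ → (T → ℝ) → ℝ := fun z w => 1 - ∑ a, if 1 < z * G a w then θ a else 0 with hu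
  have hS : ∀ a, MeasurableSet {p : ℝ × (T → ℝ) | 1 < p.1 * G a p.2} := fun a =>
    measurableSet_lt measurable_const (measurable_fst.mul ((hG a).comp measurable_snd))
  have hum : Measurable (Function.uncurry u) := by
    refine measurable_const.sub (Finset.measurable_sum _ fun a _ => ?_)
    exact Measurable.ite (hS a) measurable_const measurable_const
  have hite : ∀ a z w, 0 ≤ (if 1 < z * G a w then θ a else 0) := fun a z w => by
    split_ifs <;> simp [hθ a]
  have hu1 : ∀ z w, u z w ≤ 1 := fun z w => by
    have := Finset.sum_nonneg fun a (_ : a ∈ Finset.univ) => hite a z w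
    simp only [hu]; linarith
  have hu0 : ∀ z w, 0 ≤ u z w := fun z w => by
    have : ∑ a, (if 1 < z * G a w then θ a else 0) ≤ ∑ a, θ a :=
      Finset.sum_le_sum fun a _ => by split_ifs <;> simp [hθ a]
    simp only [hu]; linarith
  have hinner : ∀ ω, ∫⁻ z, ENNReal.ofReal (1 - u z (Y 0 ω)) ∂frechetIntensity
      = ENNReal.ofReal (∑ a, θ a * G a (Y 0 ω)) := by
    intro ω
    have h1 : ∀ z, ENNReal.ofReal (1 - u z (Y 0 ω))
        = ∑ a, {z | 1 < z * G a (Y 0 ω)}.indicator (fun _ => ENNReal.ofReal (θ a)) z := by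
      intro z
      simp only [hu, sub_sub_cancel]
      rw [ENNReal.ofReal_sum_of_nonneg fun a _ => hite a z _]
      refine Finset.sum_congr rfl fun a _ => ?_
      rw [Set.indicator_apply]
      simp only [Set.mem_ofPred_eq]
      split_ifs <;> simp
    have h2 : ∀ a, MeasurableSet {z : ℝ | 1 < z * G a (Y 0 ω)} := fun a =>
      measurableSet_lt measurable_const (measurable_id.mul_const _)
    simp_rw [h1]
    rw [lintegral_finsetSum _ fun a _ => measurable_const.indicator (h2 a),
      ENNReal.ofReal_sum_of_nonneg fun a _ => mul_nonneg (hθ a) (hG0 a ω)]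
    refine Finset.sum_congr rfl fun a _ => ?_
    rw [lintegral_indicator_const (h2 a), frechetIntensity_one_lt_mul (hG0 a ω),
      ENNReal.ofReal_mul (hθ a)]
  have hsumi : Integrable (fun ω => ∑ a, θ a * G a (Y 0 ω)) P :=
    integrable_finsetSum _ fun a _ => (hGi a).const_mul _
  have hval : ∫⁻ ω, ∫⁻ z, ENNReal.ofReal (1 - u z (Y 0 ω)) ∂frechetIntensity ∂P
      = ENNReal.ofReal (∑ a, θ a * ∫ ω, G a (Y 0 ω) ∂P) := by
    simp_rw [hinner]
    rw [← ofReal_integral_eq_lintegral_ofReal hsumi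
      (ae_of_all _ fun ω => Finset.sum_nonneg fun a _ => mul_nonneg (hθ a) (hG0 a ω)),
      integral_finsetSum _ fun a _ => (hGi a).const_mul _]
    simp_rw [integral_const_mul]
  have key := tendsto_integral_prod_marked hη.poisson hη.measurable hη.identDistrib hη.indep
    hη.indep_poisson hum hu0 hu1 (by rw [hval]; exact ENNReal.ofReal_ne_top)
  rwa [hval, ENNReal.toReal_ofReal (Finset.sum_nonneg fun a _ =>
    mul_nonneg (hθ a) (integral_nonneg fun ω => hG0 a ω))] at key

theorem IsSpectralSystem.ae_pos [IsProbabilityMeasure P] (hη : IsSpectralSystem P ζ Y) : ∀ᵐ ω ∂P, ∀ i, 0 < ζ i ω := by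
  have h0 : frechetIntensity (Set.Iic 0) ≠ ∞ := by
    rw [frechetIntensity_Iic_zero]; exact ENNReal.zero_ne_top
  have h1 := hη.poisson.count_law _ measurableSet_Iic h0
  have h2 : ∀ᵐ ω ∂P, pointCount ζ (Set.Iic 0) ω = 0 := by
    refine ae_of_ae_map (p := fun q => q = 0)
      (aemeasurable_pointCount hη.poisson measurableSet_Iic h0) ?_
    rw [h1, ae_map_iff (by fun_prop) (by measurability), frechetIntensity_Iic_zero]
    rw [ae_iff_of_countable]
    intro q hq
    rw [poissonMeasure_singleton] at hq
    by_contra hq0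
    have : q ≠ 0 := fun h => hq0 (by simp [h])
    simp [this] at hq
  filter_upwards [h2] with ω hω i
  have : {i | ζ i ω ∈ Set.Iic 0} = ∅ := Set.encard_eq_zero.1 hω
  by_contra hi
  have hmem : i ∈ {i | ζ i ω ∈ Set.Iic 0} := not_lt.1 hi
  rw [this] at hmem
  exact hmem

theorem IsSpectralSystem.measurable_eval (hη : IsSpectralSystem P ζ Y) (i : ℕ) (t : T) :
    Measurable (fun ω => Y i ω t) := (measurable_pi_apply t).comp (hη.measurable i)

theorem IsSpectralSystem.measurable_spectralFun (hη : IsSpectralSystem P ζ Y) (i : ℕ) (t : T) :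
    Measurable (fun ω => spectralFun ζ Y i ω t) :=
  (hη.poisson.measurable i).mul (hη.measurable_eval i t)

theorem IsSpectralSystem.measurable_maxStable (hη : IsSpectralSystem P ζ Y) (t : T) :
    Measurable (fun ω => maxStable ζ Y ω t) :=
  Measurable.iSup fun i => hη.measurable_spectralFun i t

theorem IsSpectralSystem.integrable_eval (hη : IsSpectralSystem P ζ Y) (t : T) :
    Integrable (fun ω => Y 0 ω t) P := by
  refine ⟨(hη.measurable_eval 0 t).aestronglyMeasurable, ?_⟩
  rw [hasFiniteIntegral_iff_ofReal (ae_of_all _ fun ω => hη.nonneg 0 ω t), hη.mean_eq_one]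
  exact ENNReal.one_lt_top

theorem IsSpectralSystem.integral_eval (hη : IsSpectralSystem P ζ Y) (t : T) :
    ∫ ω, Y 0 ω t ∂P = 1 := by
  rw [integral_eq_lintegral_of_nonneg_ae (ae_of_all _ fun ω => hη.nonneg 0 ω t)
    (hη.measurable_eval 0 t).aestronglyMeasurable, hη.mean_eq_one, ENNReal.toReal_one]

/-- Above any positive level there are almost surely only finitely many of the values `φ_i(t)`. -/
theorem IsSpectralSystem.ae_finite_exceedance [IsProbabilityMeasure P] (hη : IsSpectralSystem P ζ Y) (t : T) {c : ℝ}
    (hc : 0 < c) : ∀ᵐ ω ∂P, {i | c < spectralFun ζ Y i ω t}.Finite := by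
  classical
  set B : Set Ω := {ω | {i | c < spectralFun ζ Y i ω t}.Infinite} with hB
  have hmem : ∀ i ω, 1 < ζ i ω * (c⁻¹ * Y i ω t) ↔ c < spectralFun ζ Y i ω t := by
    intro i ω
    rw [spectralFun, ← mul_assoc, mul_comm (ζ i ω), mul_assoc, inv_mul_eq_div, one_lt_div hc]
  have hBm : MeasurableSet B := by
    have : B = {ω | ∃ᶠ i in atTop, c < spectralFun ζ Y i ω t} := by
      ext ω
      simp only [hB, Set.mem_ofPred_eq]
      rw [Nat.frequently_atTop_iff_infinite]
    rw [this]
    have h2 : {ω | ∃ᶠ i in atTop, c < spectralFun ζ Y i ω t}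
        = limsup (fun i => {ω | c < spectralFun ζ Y i ω t}) atTop := by
      rw [limsup_eq_iInf_iSup_of_nat]
      ext ω
      simp [frequently_atTop]
    rw [h2]
    exact MeasurableSet.measurableSet_limsup fun i =>
      measurableSet_lt measurable_const (hη.measurable_spectralFun i t)
  -- On B infinitely many factors equal 1 - θ, so the product tends to 0 there. Its limiting
  -- expectation exp(-θ/c) is thus at most P(Bᶜ); letting θ → 0 gives P(B) = 0.
  have hb : ∀ θ : ℝ, 0 < θ → θ ≤ 1 → P.real Bᶜ ≥ Real.exp (-(θ * c⁻¹)) := by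
    intro θ hθ hθ1
    have h1 := hη.tendsto_integral_prod_exceedance (ι := Unit) (θ := fun _ => θ)
      (G := fun _ w => c⁻¹ * w t) (fun _ => hθ.le) (by simpa using hθ1)
      (fun _ => (measurable_pi_apply t).const_mul _)
      (fun _ ω => mul_nonneg (inv_nonneg.2 hc.le) (hη.nonneg 0 ω t))
      (fun _ => (hη.integrable_eval t).const_mul _)
    simp only [Finset.univ_unique, Finset.sum_singleton, integral_const_mul,
      hη.integral_eval t, mul_one, hmem] at h1
    set F : ℕ → Ω → ℝ := fun n ω => ∏ i ∈ Finset.range n,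
      (1 - if c < spectralFun ζ Y i ω t then θ else 0) with hF
    have hFm : ∀ n, Measurable (F n) := fun n =>
      Finset.measurable_prod _ fun i _ => measurable_const.sub
        (Measurable.ite (measurableSet_lt measurable_const (hη.measurable_spectralFun i t))
          measurable_const measurable_const)
    have hF01 : ∀ n ω, 0 ≤ F n ω ∧ F n ω ≤ 1 := fun n ω => by
      have := prod_range_mem_Icc (f := fun i => 1 - if c < spectralFun ζ Y i ω t then θ else 0)
        (fun i => by split_ifs <;> simp [hθ1]) (fun i => by split_ifs <;> simp [hθ.le]) n
      exact this
    have hFB : ∀ ω ∈ B, Tendsto (fun n => F n ω) atTop (𝓝 0) := by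
      intro ω hω
      have hanti : Antitone (fun n => F n ω) := antitone_nat_of_succ_le fun n => by
        simp only [hF, Finset.prod_range_succ]
        refine mul_le_of_le_one_right (hF01 n ω).1 ?_
        split_ifs <;> simp [hθ.le]
      have hle : ∀ N : ℕ, ∃ n, F n ω ≤ (1 - θ) ^ N := by
        intro N
        obtain ⟨S, hS, hScard⟩ := hω.exists_subset_card_eq N
        refine ⟨S.sup id + 1, ?_⟩
        have hsub : S ⊆ Finset.range (S.sup id + 1) := fun i hi =>
          Finset.mem_range.2 (Nat.lt_succ_of_le (Finset.le_sup (f := id) hi))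
        calc F (S.sup id + 1) ω ≤ ∏ i ∈ S, (1 - if c < spectralFun ζ Y i ω t then θ else 0) := by
              simp only [hF]
              rw [← Finset.prod_sdiff hsub]
              refine mul_le_of_le_one_left (Finset.prod_nonneg fun i _ => ?_)
                (Finset.prod_le_one (fun i _ => ?_) fun i _ => ?_) <;>
              split_ifs <;> simp [hθ.le, hθ1]
          _ = (1 - θ) ^ N := by
              rw [← hScard]
              refine Finset.prod_eq_pow_card fun i hi => ?_
              have : c < spectralFun ζ Y i ω t := hS hi
              simp [this]
      refine tendsto_order.2 ⟨fun a ha => Eventually.of_forall fun n => ha.trans_le (hF01 n ω).1, ?_⟩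
      intro a ha
      obtain ⟨N, hN⟩ := exists_pow_lt_of_lt_one ha (show 1 - θ < 1 by linarith)
      obtain ⟨n, hn⟩ := hle N
      filter_upwards [eventually_ge_atTop n] with n' hn'
      exact ((hanti hn').trans hn).trans_lt hN
    have hFi : ∀ n, Integrable (F n) P := fun n =>
      (integrable_const (1 : ℝ)).mono' (hFm n).aestronglyMeasurable
        (ae_of_all _ fun ω => by rw [Real.norm_of_nonneg (hF01 n ω).1]; exact (hF01 n ω).2)
    have hBlim : Tendsto (fun n => ∫ ω, B.indicator (F n) ω ∂P) atTop (𝓝 0) := by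
      have := tendsto_integral_of_dominated_convergence (μ := P) (F := fun n => B.indicator (F n))
        (f := fun _ => 0) (fun _ => 1)
        (fun n => ((hFm n).indicator hBm).aestronglyMeasurable) (integrable_const _)
        (fun n => ae_of_all _ fun ω => by
          rw [Set.indicator_apply]
          split_ifs
          · rw [Real.norm_of_nonneg (hF01 n ω).1]; exact (hF01 n ω).2
          · simp)
        (ae_of_all _ fun ω => by
          by_cases hω : ω ∈ B
          · simpa [Set.indicator_of_mem hω] using hFB ω hω
          · simp [Set.indicator_of_notMem hω])
      simpa using this
    have hle : ∀ n, ∫ ω, F n ω ∂P ≤ (∫ ω, B.indicator (F n) ω ∂P) + P.real Bᶜ := by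
      intro n
      have h3 : P.real Bᶜ = ∫ ω, Bᶜ.indicator (fun _ => (1 : ℝ)) ω ∂P := by
        rw [integral_indicator_const _ hBm.compl]; simp
      rw [h3, ← integral_add ((hFi n).indicator hBm)
        ((integrable_const _).indicator hBm.compl)]
      refine integral_mono (hFi n) (((hFi n).indicator hBm).add
        ((integrable_const _).indicator hBm.compl)) fun ω => ?_
      by_cases hω : ω ∈ B
      · simp [hω]
      · simp [hω, (hF01 n ω).2]
    have h4 := le_of_tendsto_of_tendsto' h1 (hBlim.add_const _) hle
    simpa using h4
  have h1 : P.real Bᶜ ≥ 1 := by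
    have ht : Tendsto (fun θ : ℝ => Real.exp (-(θ * c⁻¹))) (𝓝[>] 0) (𝓝 1) := by
      have : Continuous (fun θ : ℝ => Real.exp (-(θ * c⁻¹))) := by fun_prop
      have h2 := this.tendsto 0
      simp only [zero_mul, neg_zero, Real.exp_zero] at h2
      exact h2.mono_left nhdsWithin_le_nhds
    refine le_of_tendsto ht ?_
    filter_upwards [Ioc_mem_nhdsGT (show (0 : ℝ) < 1 by norm_num)] with θ hθ
    exact hb θ hθ.1 hθ.2
  have h2 : P B = 0 := by
    have h3 := probReal_compl_eq_one_sub (μ := P) hBm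
    have h4 : P.real B = 0 := le_antisymm (by linarith) measureReal_nonneg
    exact (measureReal_eq_zero_iff).1 h4
  rw [ae_iff]
  exact h2

end Spectral

/-! ### Independent uniform labels -/

/-- The law of a sequence of independent labels, uniformly distributed on `Fin m`. -/
noncomputable def labelMeasure (m : ℕ) [NeZero m] : Measure (ℕ → Fin m) :=
  Measure.infinitePi fun _ => (PMF.uniformOfFintype (Fin m)).toMeasure

instance (m : ℕ) [NeZero m] : IsProbabilityMeasure (labelMeasure m) := by
  unfold labelMeasure; infer_instance

open Classical in
theorem uniform_apply_eq_ofReal (m : ℕ) [NeZero m] (q : Fin m → Prop) :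
    (PMF.uniformOfFintype (Fin m)).toMeasure {a | ¬ q a}
      = ENNReal.ofReal (1 - ∑ a, if q a then (m : ℝ)⁻¹ else 0) := by
  have hm : (m : ℝ) ≠ 0 := Nat.cast_ne_zero.2 (NeZero.ne m)
  have h1 : (1 : ℝ) - ∑ a, (if q a then (m : ℝ)⁻¹ else 0)
      = ∑ a, if ¬ q a then (m : ℝ)⁻¹ else 0 := by
    have : (1 : ℝ) = ∑ _a : Fin m, (m : ℝ)⁻¹ := by simp [hm]
    rw [this, ← Finset.sum_sub_distrib]
    refine Finset.sum_congr rfl fun a _ => ?_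
    split_ifs <;> simp
  rw [h1, ENNReal.ofReal_sum_of_nonneg fun a _ => by split_ifs <;> simp,
    PMF.toMeasure_apply_fintype]
  refine Finset.sum_congr rfl fun a _ => ?_
  rw [Set.indicator_apply]
  simp only [Set.mem_ofPred_eq, PMF.uniformOfFintype_apply, Fintype.card_fin]
  split_ifs
  · simp
  · rw [ENNReal.ofReal_inv_of_pos (by positivity [NeZero.pos m]), ENNReal.ofReal_natCast]

theorem labelMeasure_forall_mem_eq (m : ℕ) [NeZero m] (S : Finset ℕ) (f : ℕ → Fin m) :
    labelMeasure m {l | ∀ i ∈ S, l i = f i} = ((m : ℝ≥0∞)⁻¹) ^ S.card := by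
  have : {l : ℕ → Fin m | ∀ i ∈ S, l i = f i} = (S : Set ℕ).pi fun i => {f i} := by
    ext l; simp [Set.mem_pi]
  rw [this, labelMeasure, Measure.infinitePi_pi _ fun i _ => measurableSet_singleton _]
  refine Finset.prod_eq_pow_card fun i _ => ?_
  rw [PMF.toMeasure_apply_singleton _ _ (measurableSet_singleton _),
    PMF.uniformOfFintype_apply, Fintype.card_fin]

section LabelMax

variable {Ω T : Type*} {ζ : ℕ → Ω → ℝ} {Y : ℕ → Ω → T → ℝ}

/-- The maximum of the functions `φ_i` with label `a`. -/
noncomputable def labelMax (ζ : ℕ → Ω → ℝ) (Y : ℕ → Ω → T → ℝ) {m : ℕ} (a : Fin m) (p : Ω × (ℕ → Fin m)) (t : T) : ℝ :=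
  ⨆ i : ℕ, if p.2 i = a then spectralFun ζ Y i p.1 t else 0

/-- The default value 0 for functions with another label is invisible at levels x ≥ 0. Boundedness
is needed because an unbounded real supremum is 0 by convention. -/
theorem labelMax_le_iff {m : ℕ} {a : Fin m} {ω : Ω} {l : ℕ → Fin m} {t : T}
    (hb : BddAbove (Set.range fun i => spectralFun ζ Y i ω t)) {x : ℝ} (hx : 0 ≤ x) :
    labelMax ζ Y a (ω, l) t ≤ x ↔ ∀ i, l i = a → spectralFun ζ Y i ω t ≤ x := by
  obtain ⟨M, hM⟩ := hb
  have hbdd : BddAbove (Set.range fun i => if l i = a then spectralFun ζ Y i ω t else 0) := by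
    refine ⟨max M 0, ?_⟩
    rintro _ ⟨i, rfl⟩
    simp only
    split_ifs
    · exact (hM ⟨i, rfl⟩).trans (le_max_left _ _)
    · exact le_max_right _ _
  rw [labelMax, ciSup_le_iff hbdd]
  refine forall_congr' fun i => ?_
  split_ifs with h
  · simp [h]
  · simp [h, hx]

theorem maxStable_le_iff {ω : Ω} {t : T}
    (hb : BddAbove (Set.range fun i => spectralFun ζ Y i ω t)) {x : ℝ} :
    maxStable ζ Y ω t ≤ x ↔ ∀ i, spectralFun ζ Y i ω t ≤ x :=
  ciSup_le_iff hb

end LabelMax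

/-! ### Void probabilities of labelled exceedances and one-site laws. -/

section Labels

variable {Ω T : Type*} [MeasurableSpace Ω] [TopologicalSpace T] {P : Measure Ω}
  {ζ : ℕ → Ω → ℝ} {Y : ℕ → Ω → T → ℝ}

/-- Void probabilities of the labelled exceedances. -/
theorem IsSpectralSystem.prod_labelMeasure_forall_le [IsProbabilityMeasure P]
    (hη : IsSpectralSystem P ζ Y) (m : ℕ) [NeZero m]
    {G : Fin m → (T → ℝ) → ℝ} (hG : ∀ a, Measurable (G a)) (hG0 : ∀ a ω, 0 ≤ G a (Y 0 ω))
    (hGi : ∀ a, Integrable (fun ω => G a (Y 0 ω)) P) :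
    (P.prod (labelMeasure m)) {p | ∀ i, ζ i p.1 * G (p.2 i) (Y i p.1) ≤ 1}
      = ENNReal.ofReal (Real.exp (-∑ a, (m : ℝ)⁻¹ * ∫ ω, G a (Y 0 ω) ∂P)) := by
  classical
  have hm : (m : ℝ) ≠ 0 := Nat.cast_ne_zero.2 (NeZero.ne m)
  set A : ℕ → Set (Ω × (ℕ → Fin m)) := fun n =>
    {p | ∀ i ∈ Finset.range n, ζ i p.1 * G (p.2 i) (Y i p.1) ≤ 1} with hA
  have hAm : ∀ n, MeasurableSet (A n) := by
    intro n
    have : A n = ⋂ i ∈ Finset.range n, ⋃ a : Fin m,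
        {p | p.2 i = a} ∩ {p | ζ i p.1 * G a (Y i p.1) ≤ 1} := by
      ext p
      simp [hA]
    rw [this]
    refine Finset.measurableSet_biInter _ fun i _ => MeasurableSet.iUnion fun a => ?_
    refine MeasurableSet.inter ?_ ?_
    · exact measurableSet_eq_fun ((measurable_pi_apply i).comp measurable_snd) measurable_const
    · exact measurableSet_le (((hη.poisson.measurable i).mul
        ((hG a).comp (hη.measurable i))).comp measurable_fst) measurable_const
  have hAanti : Antitone A := fun n n' h p hp i hi =>
    hp i (Finset.range_mono h hi)
  have hAi : {p : Ω × (ℕ → Fin m) | ∀ i, ζ i p.1 * G (p.2 i) (Y i p.1) ≤ 1} = ⋂ n, A n := by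
    ext p
    simp only [hA, Set.mem_iInter, Set.mem_ofPred_eq, Finset.mem_range]
    exact ⟨fun h n i _ => h i, fun h i => h (i + 1) i (Nat.lt_succ_self i)⟩
  set F : ℕ → Ω → ℝ := fun n ω => ∏ i ∈ Finset.range n,
    (1 - ∑ a, if 1 < ζ i ω * G a (Y i ω) then (m : ℝ)⁻¹ else 0) with hF
  have hfac : ∀ i ω, 0 ≤ (1 : ℝ) - ∑ a, (if 1 < ζ i ω * G a (Y i ω) then (m : ℝ)⁻¹ else 0) ∧
      (1 : ℝ) - ∑ a, (if 1 < ζ i ω * G a (Y i ω) then (m : ℝ)⁻¹ else 0) ≤ 1 := by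
    intro i ω
    have h1 : ∑ a, (if 1 < ζ i ω * G a (Y i ω) then (m : ℝ)⁻¹ else 0)
        ≤ ∑ _a : Fin m, (m : ℝ)⁻¹ :=
      Finset.sum_le_sum fun a _ => by split_ifs <;> simp
    have h2 : 0 ≤ ∑ a, (if 1 < ζ i ω * G a (Y i ω) then (m : ℝ)⁻¹ else 0) :=
      Finset.sum_nonneg fun a _ => by split_ifs <;> simp
    simp only [Finset.sum_const, Finset.card_univ, Fintype.card_fin, nsmul_eq_mul,
      mul_inv_cancel₀ hm] at h1
    constructor <;> linarith
  have hF01 : ∀ n ω, F n ω ∈ Set.Icc (0 : ℝ) 1 := fun n ω =>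
    prod_range_mem_Icc (fun i => (hfac i ω).1) (fun i => (hfac i ω).2) n
  have hFm : ∀ n, Measurable (F n) := fun n =>
    Finset.measurable_prod _ fun i _ => measurable_const.sub
      (Finset.measurable_sum _ fun a _ => Measurable.ite
        (measurableSet_lt measurable_const ((hη.poisson.measurable i).mul
          ((hG a).comp (hη.measurable i)))) measurable_const measurable_const)
  have hFi : ∀ n, Integrable (F n) P := fun n =>
    (integrable_const (1 : ℝ)).mono' (hFm n).aestronglyMeasurable
      (ae_of_all _ fun ω => by
        rw [Real.norm_of_nonneg (hF01 n ω).1]; exact (hF01 n ω).2)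
  -- For fixed ω the section of A n is a box in label space, and independence of the labels turns
  -- its measure into the product F n.
  have hmeas : ∀ n, (P.prod (labelMeasure m)) (A n) = ENNReal.ofReal (∫ ω, F n ω ∂P) := by
    intro n
    rw [Measure.prod_apply (hAm n),
      ofReal_integral_eq_lintegral_ofReal (hFi n) (ae_of_all _ fun ω => (hF01 n ω).1)]
    refine lintegral_congr fun ω => ?_
    have : Prod.mk ω ⁻¹' A n = (Finset.range n : Set ℕ).pi
        fun i => {a | ¬ 1 < ζ i ω * G a (Y i ω)} := by
      ext l
      simp [hA, Set.mem_pi]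
    rw [this, labelMeasure, Measure.infinitePi_pi _ fun i _ => MeasurableSet.of_discrete]
    simp_rw [uniform_apply_eq_ofReal]
    rw [ENNReal.ofReal_prod_of_nonneg fun i _ => (hfac i ω).1]
  have hlim1 := tendsto_measure_iInter_atTop (μ := P.prod (labelMeasure m))
    (fun n => (hAm n).nullMeasurableSet) hAanti ⟨0, measure_ne_top _ _⟩
  rw [← hAi] at hlim1
  have hlim2 := hη.tendsto_integral_prod_exceedance (θ := fun _ : Fin m => (m : ℝ)⁻¹)
    (fun _ => by positivity) (by simp [hm]) hG hG0 hGi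
  refine tendsto_nhds_unique hlim1 ?_
  refine (ENNReal.tendsto_ofReal hlim2).congr fun n => (hmeas n).symm

/-- The unlabelled void probability is the case of a single label. -/
theorem IsSpectralSystem.measure_forall_le [IsProbabilityMeasure P]
    (hη : IsSpectralSystem P ζ Y)
    {G : (T → ℝ) → ℝ} (hG : Measurable G) (hG0 : ∀ ω, 0 ≤ G (Y 0 ω))
    (hGi : Integrable (fun ω => G (Y 0 ω)) P) :
    P {ω | ∀ i, ζ i ω * G (Y i ω) ≤ 1} = ENNReal.ofReal (Real.exp (-∫ ω, G (Y 0 ω) ∂P)) := by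
  have h1 := hη.prod_labelMeasure_forall_le 1 (G := fun _ => G) (fun _ => hG) (fun _ => hG0)
    fun _ => hGi
  have h2 : {p : Ω × (ℕ → Fin 1) | ∀ i, ζ i p.1 * G (Y i p.1) ≤ 1}
      = {ω | ∀ i, ζ i ω * G (Y i ω) ≤ 1} ×ˢ Set.univ := by
    ext p; simp
  rw [h2, Measure.prod_prod, measure_univ, mul_one] at h1
  simpa using h1

theorem IsSpectralSystem.measurable_labelMax (hη : IsSpectralSystem P ζ Y) {m : ℕ} (a : Fin m)
    (t : T) : Measurable (fun p => labelMax ζ Y a p t) := by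
  refine Measurable.iSup fun i => Measurable.ite ?_ ?_ measurable_const
  · exact measurableSet_eq_fun ((measurable_pi_apply i).comp measurable_snd) measurable_const
  · exact (hη.measurable_spectralFun i t).comp measurable_fst

theorem IsSpectralSystem.ae_bddAbove [IsProbabilityMeasure P] (hη : IsSpectralSystem P ζ Y)
    (t : T) : ∀ᵐ ω ∂P, BddAbove (Set.range fun i => spectralFun ζ Y i ω t) := by
  filter_upwards [hη.ae_finite_exceedance t one_pos] with ω hω
  have h1 : (Set.range fun i => spectralFun ζ Y i ω t) ⊆
      Set.Iic 1 ∪ (fun i => spectralFun ζ Y i ω t) '' {i | 1 < spectralFun ζ Y i ω t} := by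
    rintro _ ⟨i, rfl⟩
    by_cases h : 1 < spectralFun ζ Y i ω t
    · exact Or.inr ⟨i, h, rfl⟩
    · exact Or.inl (not_lt.1 h)
  exact (bddAbove_Iic.union (hω.image _).bddAbove).mono h1

theorem IsSpectralSystem.prod_labelMax_le [IsProbabilityMeasure P] (hη : IsSpectralSystem P ζ Y)
    {m : ℕ} [NeZero m] (a : Fin m) (t : T) {c : ℝ} (hc : 0 < c) :
    (P.prod (labelMeasure m)) {p | labelMax ζ Y a p t ≤ c}
      = ENNReal.ofReal (Real.exp (-((m : ℝ)⁻¹ * c⁻¹))) := by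
  classical
  -- The zero functional for labels other than a imposes no constraint.
  have h1 := hη.prod_labelMeasure_forall_le m
    (G := fun b w => if b = a then c⁻¹ * w t else 0)
    (fun b => by
      by_cases h : b = a
      · simp only [h, if_true]; fun_prop
      · simp [h])
    (fun b ω => by
      split_ifs
      · exact mul_nonneg (inv_nonneg.2 hc.le) (hη.nonneg 0 ω t)
      · exact le_rfl)
    (fun b => by
      by_cases h : b = a
      · simpa [h] using (hη.integrable_eval t).const_mul c⁻¹
      · simp [h])
  have h2 : ∑ b : Fin m, (m : ℝ)⁻¹ * ∫ ω, (if b = a then c⁻¹ * Y 0 ω t else 0) ∂P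
      = (m : ℝ)⁻¹ * c⁻¹ := by
    rw [Finset.sum_eq_single a]
    · simp [integral_const_mul, hη.integral_eval t]
    · intro b _ hb
      simp [hb]
    · simp
  rw [h2] at h1
  rw [← h1]
  refine measure_congr ?_
  have h3 : ∀ᵐ p ∂P.prod (labelMeasure m),
      BddAbove (Set.range fun i => spectralFun ζ Y i p.1 t) :=
    Measure.quasiMeasurePreserving_fst.ae (hη.ae_bddAbove t)
  filter_upwards [h3] with p hp
  refine propext ?_
  change labelMax ζ Y a (p.1, p.2) t ≤ c ↔ _
  rw [labelMax_le_iff hp hc.le]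
  refine forall_congr' fun i => ?_
  by_cases h : p.2 i = a
  · simp only [h, if_true, forall_const, spectralFun]
    rw [mul_left_comm, inv_mul_le_one₀ hc]
  · simp [h]

theorem IsSpectralSystem.measure_maxStable_le [IsProbabilityMeasure P]
    (hη : IsSpectralSystem P ζ Y) (t : T) {c : ℝ} (hc : 0 < c) :
    P {ω | maxStable ζ Y ω t ≤ c} = ENNReal.ofReal (Real.exp (-c⁻¹)) := by
  have h1 := hη.measure_forall_le (G := fun w => c⁻¹ * w t)
    (by fun_prop)
    (fun ω => mul_nonneg (inv_nonneg.2 hc.le) (hη.nonneg 0 ω t))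
    ((hη.integrable_eval t).const_mul c⁻¹)
  rw [integral_const_mul, hη.integral_eval t, mul_one] at h1
  rw [← h1]
  refine measure_congr ?_
  filter_upwards [hη.ae_bddAbove t] with ω hω
  refine propext ?_
  change maxStable ζ Y ω t ≤ c ↔ _
  rw [maxStable_le_iff hω]
  refine forall_congr' fun i => ?_
  simp only [spectralFun]
  rw [mul_left_comm, inv_mul_le_one₀ hc]

theorem measure_le_zero_of_exp_bound {α : Type*} [MeasurableSpace α] {μ : Measure α} {f : α → ℝ}
    {κ : ℝ} (hκ : 0 < κ)
    (h : ∀ c, 0 < c → μ {x | f x ≤ c} = ENNReal.ofReal (Real.exp (-(κ * c⁻¹)))) :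
    μ {x | f x ≤ 0} = 0 := by
  have ht : Tendsto (fun c : ℝ => ENNReal.ofReal (Real.exp (-(κ * c⁻¹)))) (𝓝[>] 0) (𝓝 0) := by
    have h1 : Tendsto (fun c : ℝ => Real.exp (-(κ * c⁻¹))) (𝓝[>] 0) (𝓝 0) :=
      Real.tendsto_exp_neg_atTop_nhds_zero.comp
        (tendsto_inv_nhdsGT_zero.const_mul_atTop hκ)
    simpa using ENNReal.tendsto_ofReal h1
  refine le_antisymm (ge_of_tendsto ht ?_) zero_le
  filter_upwards [self_mem_nhdsWithin] with c hc
  rw [← h c hc]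
  exact measure_mono fun x (hx : f x ≤ 0) => le_trans hx (le_of_lt hc)

theorem IsSpectralSystem.ae_maxStable_pos [IsProbabilityMeasure P]
    (hη : IsSpectralSystem P ζ Y) (t : T) : ∀ᵐ ω ∂P, 0 < maxStable ζ Y ω t := by
  have := measure_le_zero_of_exp_bound (f := fun ω => maxStable ζ Y ω t) one_pos
    fun c hc => by rw [hη.measure_maxStable_le t hc, one_mul]
  rw [ae_iff]
  simpa using this

/-- The distribution function exp(-1/c) is continuous, so there are no atoms at positive x; there is
no mass on (-∞, 0]. -/
theorem IsSpectralSystem.measure_maxStable_eq [IsProbabilityMeasure P]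
    (hη : IsSpectralSystem P ζ Y) (t : T) (x : ℝ) : P {ω | maxStable ζ Y ω t = x} = 0 := by
  rcases le_or_gt x 0 with hx | hx
  · refine measure_mono_null (fun ω hω => ?_) (ae_iff.1 (hη.ae_maxStable_pos t))
    have : maxStable ζ Y ω t = x := hω
    simp only [Set.mem_ofPred_eq, not_lt]
    linarith
  have hm := hη.measurable_maxStable t
  have hle : ∀ c, 0 < c → P.real {ω | maxStable ζ Y ω t ≤ c} = Real.exp (-c⁻¹) := fun c hc => by
    rw [measureReal_def, hη.measure_maxStable_le t hc, ENNReal.toReal_ofReal (Real.exp_nonneg _)]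
  have hbound : ∀ c, c ∈ Set.Ioo 0 x →
      P.real {ω | maxStable ζ Y ω t = x} ≤ Real.exp (-x⁻¹) - Real.exp (-c⁻¹) := by
    intro c hc
    have h1 : P.real {ω | maxStable ζ Y ω t = x} + P.real {ω | maxStable ζ Y ω t ≤ c}
        ≤ P.real {ω | maxStable ζ Y ω t ≤ x} := by
      rw [← measureReal_union]
      · refine measureReal_mono ?_
        rintro ω (hω | hω)
        · exact le_of_eq hω
        · exact le_trans hω hc.2.le
      · rw [Set.disjoint_left]
        intro ω h2 h3
        have h4 : maxStable ζ Y ω t = x := h2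
        have h5 : maxStable ζ Y ω t ≤ c := h3
        linarith [hc.2]
      · exact measurableSet_le hm measurable_const
    rw [hle c hc.1, hle x hx] at h1
    linarith
  have ht : Tendsto (fun c : ℝ => Real.exp (-x⁻¹) - Real.exp (-c⁻¹)) (𝓝[<] x) (𝓝 0) := by
    have h1 : ContinuousAt (fun c : ℝ => Real.exp (-x⁻¹) - Real.exp (-c⁻¹)) x := by
      have := continuousAt_inv₀ hx.ne'
      fun_prop
    have h2 := h1.tendsto
    simp only [sub_self] at h2
    exact h2.mono_left nhdsWithin_le_nhds
  have h3 : P.real {ω | maxStable ζ Y ω t = x} ≤ 0 := by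
    refine ge_of_tendsto ht ?_
    filter_upwards [Ioo_mem_nhdsLT hx] with c hc
    exact hbound c hc
  exact (measureReal_eq_zero_iff).1 (le_antisymm h3 measureReal_nonneg)

theorem IsSpectralSystem.iSup_div_nonneg (hη : IsSpectralSystem P ζ Y) {x : T → ℝ}
    (hx : ∀ t, 0 < x t) (ω : Ω) : 0 ≤ ⨆ t, Y 0 ω t / x t :=
  Real.iSup_nonneg fun t => div_nonneg (hη.nonneg 0 ω t) (hx t).le

theorem IsSpectralSystem.ae_forall_bddAbove [Countable T] [IsProbabilityMeasure P]
    (hη : IsSpectralSystem P ζ Y) :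
    ∀ᵐ ω ∂P, ∀ t, BddAbove (Set.range fun i => spectralFun ζ Y i ω t) :=
  ae_all_iff.2 fun t => hη.ae_bddAbove t

end Labels

/-! ### The joint law of the labelled maxima -/

/-- Lower orthants form the π-system on which the joint law of the labelled maxima is identified. -/
theorem generateFrom_range_Iic_pi (T : Type*) [Finite T] :
    MeasurableSpace.generateFrom (Set.range (Set.Iic : (T → ℝ) → Set (T → ℝ)))
      = MeasurableSpace.pi := by
  have h1 : IsCountablySpanning (Set.range (Set.Iic : ℝ → Set ℝ)) := by
    refine ⟨fun n : ℕ => Set.Iic (n : ℝ), fun n => ⟨n, rfl⟩, ?_⟩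
    refine Set.eq_univ_of_forall fun x => ?_
    obtain ⟨n, hn⟩ := exists_nat_ge x
    exact Set.mem_iUnion.2 ⟨n, hn⟩
  rw [← generateFrom_eq_pi (C := fun _ : T => Set.range (Set.Iic : ℝ → Set ℝ))
    (fun _ => by rw [← borel_eq_generateFrom_Iic, (BorelSpace.measurable_eq (α := ℝ))])
    (fun _ => h1)]
  congr 1
  ext A
  constructor
  · rintro ⟨x, rfl⟩
    exact ⟨fun t => Set.Iic (x t), fun t _ => ⟨x t, rfl⟩, Set.pi_univ_Iic x⟩
  · rintro ⟨B, hB, rfl⟩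
    choose x hx using fun t => hB t (Set.mem_univ t)
    refine ⟨x, ?_⟩
    rw [← Set.pi_univ_Iic]
    exact congrArg _ (funext hx)

/-- Constraints at all sites collapse into one exceedance condition for the functional w ↦ max_t w_t
/ x_t, which the void probability formula can handle. -/
theorem mul_iSup_div_le_one_iff {T : Type*} [Finite T] [Nonempty T] {z : ℝ} (hz : 0 < z) {x : T → ℝ} (hx : ∀ t, 0 < x t) (w : T → ℝ) :
    z * (⨆ t, w t / x t) ≤ 1 ↔ ∀ t, z * w t ≤ x t := by
  rw [← le_div_iff₀' hz, ciSup_le_iff (Set.finite_range _).bddAbove]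
  refine forall_congr' fun t => ?_
  rw [div_le_div_iff₀ (hx t) hz, one_mul, mul_comm]

theorem measurable_iSup_div {T : Type*} [Finite T] (x : T → ℝ) : Measurable (fun w : T → ℝ => ⨆ t, w t / x t) :=
  Measurable.iSup fun t => (measurable_pi_apply t).div_const _

section LabelLaw

variable {Ω T : Type*} [MeasurableSpace Ω] [TopologicalSpace T] [Finite T] [Nonempty T]
  {P : Measure Ω} {ζ : ℕ → Ω → ℝ} {Y : ℕ → Ω → T → ℝ}

theorem IsSpectralSystem.integrable_iSup_div (hη : IsSpectralSystem P ζ Y) {x : T → ℝ}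
    (hx : ∀ t, 0 < x t) : Integrable (fun ω => ⨆ t, Y 0 ω t / x t) P := by
  have := Fintype.ofFinite T
  refine Integrable.mono' (g := fun ω => ∑ t, Y 0 ω t / x t)
    (integrable_finsetSum _ fun t _ => (hη.integrable_eval t).div_const _)
    ((measurable_iSup_div x).comp (hη.measurable 0)).aestronglyMeasurable
    (ae_of_all _ fun ω => ?_)
  rw [Real.norm_of_nonneg (hη.iSup_div_nonneg hx ω)]
  exact ciSup_le fun t => Finset.single_le_sum (f := fun t => Y 0 ω t / x t)
    (fun t _ => div_nonneg (hη.nonneg 0 ω t) (hx t).le) (Finset.mem_univ t)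

theorem IsSpectralSystem.measure_maxStable_Iic [IsProbabilityMeasure P]
    (hη : IsSpectralSystem P ζ Y) {x : T → ℝ} (hx : ∀ t, 0 < x t) :
    P {ω | maxStable ζ Y ω ≤ x}
      = ENNReal.ofReal (Real.exp (-∫ ω, (⨆ t, Y 0 ω t / x t) ∂P)) := by
  rw [← hη.measure_forall_le (measurable_iSup_div x) (hη.iSup_div_nonneg hx)
    (hη.integrable_iSup_div hx)]
  refine measure_congr ?_
  filter_upwards [hη.ae_forall_bddAbove, hη.ae_pos] with ω hω hpos
  refine propext ?_
  change (∀ t, maxStable ζ Y ω t ≤ x t) ↔ ∀ i, ζ i ω * (⨆ t, Y i ω t / x t) ≤ 1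
  simp_rw [maxStable_le_iff (hω _), mul_iSup_div_le_one_iff (hpos _) hx]
  exact forall_comm

/-- The label probability 1/m cancels the scaling by m, and the exponent is a sum over labels; the
exponential of that sum is the product form that expresses independence. -/
theorem IsSpectralSystem.prod_labelMax_Iic [IsProbabilityMeasure P]
    (hη : IsSpectralSystem P ζ Y) {m : ℕ} [NeZero m] {x : Fin m → T → ℝ}
    (hx : ∀ a t, 0 < x a t) :
    (P.prod (labelMeasure m)) {p | ∀ a t, m * labelMax ζ Y a p t ≤ x a t}
      = ∏ a, ENNReal.ofReal (Real.exp (-∫ ω, (⨆ t, Y 0 ω t / x a t) ∂P)) := by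
  have hm : (0 : ℝ) < m := Nat.cast_pos.2 (NeZero.pos m)
  have hx' : ∀ a t, 0 < x a t / m := fun a t => div_pos (hx a t) hm
  have h1 := hη.prod_labelMeasure_forall_le m (G := fun a w => ⨆ t, w t / (x a t / m))
    (fun a => measurable_iSup_div _) (fun a => hη.iSup_div_nonneg (hx' a))
    (fun a => hη.integrable_iSup_div (hx' a))
  have h2 : ∀ a, (m : ℝ)⁻¹ * ∫ ω, (⨆ t, Y 0 ω t / (x a t / m)) ∂P
      = ∫ ω, (⨆ t, Y 0 ω t / x a t) ∂P := by
    intro a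
    rw [← integral_const_mul]
    congr 1
    ext ω
    rw [Real.mul_iSup_of_nonneg (inv_nonneg.2 hm.le)]
    congr 1
    ext t
    field_simp
  simp_rw [h2] at h1
  rw [← Finset.sum_neg_distrib, Real.exp_sum,
    ENNReal.ofReal_prod_of_nonneg fun a _ => Real.exp_nonneg _] at h1
  rw [← h1]
  refine measure_congr ?_
  filter_upwards [Measure.quasiMeasurePreserving_fst.ae hη.ae_forall_bddAbove,
    Measure.quasiMeasurePreserving_fst.ae hη.ae_pos] with p hb hpos
  refine propext ?_
  change (∀ a t, m * labelMax ζ Y a (p.1, p.2) t ≤ x a t) ↔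
    ∀ i, ζ i p.1 * (⨆ t, Y i p.1 t / (x (p.2 i) t / m)) ≤ 1
  simp_rw [← le_div_iff₀' hm]
  simp_rw [labelMax_le_iff (hb _) (hx' _ _).le, mul_iSup_div_le_one_iff (hpos _) (hx' _)]
  exact ⟨fun h i t => h _ t i rfl, fun h a t i hi => hi ▸ h i t⟩

theorem IsSpectralSystem.map_labelMax [IsProbabilityMeasure P] (hη : IsSpectralSystem P ζ Y)
    {m : ℕ} [NeZero m] :
    (P.prod (labelMeasure m)).map (fun p (a : Fin m) t => m * labelMax ζ Y a p t)
      = Measure.pi fun _ => P.map (maxStable ζ Y) := by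
  have hm : (0 : ℝ) < m := Nat.cast_pos.2 (NeZero.pos m)
  have hηm : Measurable (maxStable ζ Y) := measurable_pi_lambda _ fun t => hη.measurable_maxStable t
  have hLm : Measurable (fun (p : Ω × (ℕ → Fin m)) (a : Fin m) t => m * labelMax ζ Y a p t) :=
    measurable_pi_lambda _ fun a => measurable_pi_lambda _ fun t =>
      (hη.measurable_labelMax a t).const_mul _
  have : IsProbabilityMeasure (P.map (maxStable ζ Y)) :=
    Measure.isProbabilityMeasure_map hηm.aemeasurable
  have hIicm : ∀ x : T → ℝ, MeasurableSet (Set.Iic x) := fun x => measurableSet_Iic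
  refine (Measure.pi_eq_generateFrom (C := fun _ => Set.range Set.Iic)
    (fun _ => generateFrom_range_Iic_pi T) ?_ ?_ ?_).symm
  · rintro _ _ ⟨x, rfl⟩ _ ⟨y, rfl⟩ _
    exact ⟨x ⊓ y, Set.Iic_inter_Iic.symm⟩
  · intro _
    refine ⟨fun n => Set.Iic fun _ => (n : ℝ), fun n => ⟨_, rfl⟩, fun n => measure_lt_top _ _, ?_⟩
    refine Set.eq_univ_of_forall fun x => ?_
    obtain ⟨M, hM⟩ := (Set.finite_range x).bddAbove
    obtain ⟨n, hn⟩ := exists_nat_ge M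
    exact Set.mem_iUnion.2 ⟨n, fun t => (hM ⟨t, rfl⟩).trans hn⟩
  · intro s hs
    choose x hx using hs
    obtain rfl : (fun a => Set.Iic (x a)) = s := funext hx
    have e1 : ((P.prod (labelMeasure m)).map (fun p (a : Fin m) t => m * labelMax ζ Y a p t))
        (Set.univ.pi fun a => Set.Iic (x a))
        = (P.prod (labelMeasure m)) {p | ∀ a t, m * labelMax ζ Y a p t ≤ x a t} := by
      rw [Measure.map_apply hLm (MeasurableSet.univ_pi fun a => hIicm _)]
      congr 1
      ext p
      simp [Pi.le_def]
    have e2 : ∀ a, (P.map (maxStable ζ Y)) (Set.Iic (x a)) = P {ω | maxStable ζ Y ω ≤ x a} :=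
      fun a => Measure.map_apply hηm (hIicm _)
    rw [e1]
    simp_rw [e2]
    -- If some coordinate is nonpositive, both sides vanish, since the labelled maxima and η are
    -- a.s. positive.
    by_cases hpos : ∀ a t, 0 < x a t
    · rw [hη.prod_labelMax_Iic hpos]
      exact Finset.prod_congr rfl fun a _ => (hη.measure_maxStable_Iic (hpos a)).symm
    · push Not at hpos
      obtain ⟨a, t, hat⟩ := hpos
      rw [Finset.prod_eq_zero (Finset.mem_univ a)]
      · refine measure_mono_null (fun p hp => ?_) (measure_le_zero_of_exp_bound
          (f := fun p => labelMax ζ Y a p t) (inv_pos.2 hm) fun c hc => hη.prod_labelMax_le a t hc)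
        have := (hp a t).trans hat
        exact nonpos_of_mul_nonpos_right this hm
      · refine measure_mono_null (fun ω hω => ?_) (ae_iff.1 (hη.ae_maxStable_pos t))
        exact not_lt.2 ((hω t).trans hat)

end LabelLaw

/-! ### Almost sure uniqueness of the maximizing function -/

theorem measure_eq_of_indepFun {α : Type*} [MeasurableSpace α] {μ : Measure α}
    [IsProbabilityMeasure μ] {f g : α → ℝ} (hf : Measurable f) (hg : Measurable g)
    (hfg : IndepFun f g μ) (h : ∀ x, μ {a | g a = x} = 0) : μ {a | f a = g a} = 0 := by
  have h1 := (indepFun_iff_map_prod_eq_prod_map_map hf.aemeasurable hg.aemeasurable).1 hfg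
  have hD : MeasurableSet {p : ℝ × ℝ | p.1 = p.2} := measurableSet_eq_fun measurable_fst measurable_snd
  have h2 : μ {a | f a = g a} = (μ.map fun a => (f a, g a)) {p | p.1 = p.2} := by
    rw [Measure.map_apply (hf.prodMk hg) hD]
    rfl
  rw [h2, h1, Measure.prod_apply hD]
  have h3 : ∀ x, (μ.map g) (Prod.mk x ⁻¹' {p : ℝ × ℝ | p.1 = p.2}) = 0 := fun x => by
    rw [Measure.map_apply hg (measurable_prodMk_left hD), ← h x]
    congr 1
    ext a
    exact eq_comm
  simp_rw [h3, lintegral_zero]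

section Argmax

variable {Ω T : Type*} {ζ : ℕ → Ω → ℝ} {Y : ℕ → Ω → T → ℝ}

theorem bddAbove_of_mem_argmaxSet {ω : Ω} {t : T} {i : ℕ} (hi : i ∈ argmaxSet ζ Y ω t) :
    BddAbove (Set.range fun i => spectralFun ζ Y i ω t) :=
  ⟨_, by rintro _ ⟨l, rfl⟩; exact hi l⟩

theorem maxStable_eq_of_mem_argmaxSet {ω : Ω} {t : T} {i : ℕ} (hi : i ∈ argmaxSet ζ Y ω t) :
    maxStable ζ Y ω t = spectralFun ζ Y i ω t :=
  le_antisymm ((maxStable_le_iff (bddAbove_of_mem_argmaxSet hi)).2 hi)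
    ((maxStable_le_iff (bddAbove_of_mem_argmaxSet hi)).1 le_rfl i)

theorem labelMax_eq_of_mem_argmaxSet {m : ℕ} {ω : Ω} {l : ℕ → Fin m} {t : T} {i : ℕ}
    (hi : i ∈ argmaxSet ζ Y ω t) (h0 : 0 ≤ spectralFun ζ Y i ω t) :
    labelMax ζ Y (l i) (ω, l) t = spectralFun ζ Y i ω t := by
  have hb := bddAbove_of_mem_argmaxSet hi
  have hle : labelMax ζ Y (l i) (ω, l) t ≤ spectralFun ζ Y i ω t :=
    (labelMax_le_iff hb h0).2 fun i' _ => hi i'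
  refine le_antisymm hle ?_
  have hbdd : BddAbove (Set.range fun i' => if l i' = l i then spectralFun ζ Y i' ω t else 0) := by
    refine ⟨spectralFun ζ Y i ω t, ?_⟩
    rintro _ ⟨i', rfl⟩
    simp only
    split_ifs
    · exact hi i'
    · exact h0
  have := le_ciSup hbdd i
  simpa [labelMax] using this

theorem labelMax_le_of_mem_argmaxSet {m : ℕ} {ω : Ω} {l : ℕ → Fin m} {t : T} {i : ℕ} (a : Fin m)
    (hi : i ∈ argmaxSet ζ Y ω t) (h0 : 0 ≤ spectralFun ζ Y i ω t) :
    labelMax ζ Y a (ω, l) t ≤ spectralFun ζ Y i ω t :=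
  (labelMax_le_iff (bddAbove_of_mem_argmaxSet hi) h0).2 fun i' _ => hi i'

variable [MeasurableSpace Ω] [TopologicalSpace T] {P : Measure Ω} [IsProbabilityMeasure P]

/-- The supremum is positive, and only finitely many values exceed a positive level below it, so it
is attained among those. -/
theorem IsSpectralSystem.ae_nonempty_argmaxSet (hη : IsSpectralSystem P ζ Y) (t : T) :
    ∀ᵐ ω ∂P, (argmaxSet ζ Y ω t).Nonempty := by
  have h1 : ∀ᵐ ω ∂P, ∀ n : ℕ, {i | 1 / ((n : ℝ) + 1) < spectralFun ζ Y i ω t}.Finite :=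
    ae_all_iff.2 fun n => hη.ae_finite_exceedance t Nat.one_div_pos_of_nat
  filter_upwards [h1, hη.ae_bddAbove t, hη.ae_maxStable_pos t] with ω hfin hb hpos
  obtain ⟨n, hn⟩ := exists_nat_one_div_lt hpos
  have hne : {i | 1 / ((n : ℝ) + 1) < spectralFun ζ Y i ω t}.Nonempty := by
    by_contra h
    refine absurd ((maxStable_le_iff hb).2 fun i => ?_) (not_le.2 hn)
    by_contra hi
    exact h ⟨i, not_le.1 hi⟩
  obtain ⟨i, hi, hmax⟩ := Set.exists_max_image _ (fun i => spectralFun ζ Y i ω t) (hfin n) hne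
  refine ⟨i, fun l => ?_⟩
  by_cases hl : 1 / ((n : ℝ) + 1) < spectralFun ζ Y l ω t
  · exact hmax l hl
  · exact (not_lt.1 hl).trans (le_of_lt hi)

variable [Finite T] [Nonempty T]

/-- Up to the factor m these are independent variables with atomless laws, so they a.s. do not tie.
-/
theorem IsSpectralSystem.ae_labelMax_ne (hη : IsSpectralSystem P ζ Y) (m : ℕ) [NeZero m] :
    ∀ᵐ p ∂P.prod (labelMeasure m), ∀ a b : Fin m, a ≠ b → ∀ t,
      labelMax ζ Y a p t ≠ labelMax ζ Y b p t := by
  have hm : (m : ℝ) ≠ 0 := Nat.cast_ne_zero.2 (NeZero.ne m)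
  have hηm : Measurable (maxStable ζ Y) := measurable_pi_lambda _ fun t => hη.measurable_maxStable t
  have hLm : Measurable (fun (p : Ω × (ℕ → Fin m)) (a : Fin m) t => m * labelMax ζ Y a p t) :=
    measurable_pi_lambda _ fun a => measurable_pi_lambda _ fun t =>
      (hη.measurable_labelMax a t).const_mul _
  have : IsProbabilityMeasure (P.map (maxStable ζ Y)) :=
    Measure.isProbabilityMeasure_map hηm.aemeasurable
  rw [ae_all_iff]; intro a
  rw [ae_all_iff]; intro b
  by_cases hab : a = b
  · simp [hab]
  simp only [ne_eq, hab, not_false_eq_true, forall_const]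
  rw [ae_all_iff]; intro t
  have hev : ∀ a : Fin m, Measurable (fun v : Fin m → T → ℝ => v a t) := fun a => by fun_prop
  have key : (Measure.pi fun _ : Fin m => P.map (maxStable ζ Y)) {v | v a t = v b t} = 0 := by
    refine measure_eq_of_indepFun (hev a) (hev b) ?_ fun x => ?_
    · have h1 := iIndepFun_pi (μ := fun _ : Fin m => P.map (maxStable ζ Y))
        (X := fun _ (w : T → ℝ) => w t) (fun _ => (measurable_pi_apply t).aemeasurable)
      exact h1.indepFun hab
    · have hS : MeasurableSet {w : T → ℝ | w t = x} :=
        measurableSet_eq_fun (measurable_pi_apply t) measurable_const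
      have h2 := (measurePreserving_eval (fun _ : Fin m => P.map (maxStable ζ Y)) b).measure_preimage
        hS.nullMeasurableSet
      rw [Measure.map_apply hηm hS] at h2
      exact h2.trans (hη.measure_maxStable_eq t x)
  rw [← hη.map_labelMax, Measure.map_apply hLm (measurableSet_eq_fun (hev a) (hev b))] at key
  rw [ae_iff]
  refine measure_mono_null (fun p hp => ?_) key
  have hp' : labelMax ζ Y a p t = labelMax ζ Y b p t := by simpa using hp
  change (m : ℝ) * labelMax ζ Y a p t = m * labelMax ζ Y b p t
  rw [hp']

/-- If two functions tied at the maximum, two-valued labels would separate them with positive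
probability, producing a tie between the two labelled maxima; that is a null event. -/
theorem IsSpectralSystem.ae_subsingleton_argmaxSet (hη : IsSpectralSystem P ζ Y) (t : T) :
    ∀ᵐ ω ∂P, (argmaxSet ζ Y ω t).Subsingleton := by
  have h1 := Measure.ae_ae_of_ae_prod (hη.ae_labelMax_ne 2)
  filter_upwards [h1, hη.ae_maxStable_pos t] with ω hω hpos i hi i' hi'
  by_contra hne
  have hφ : spectralFun ζ Y i ω t = spectralFun ζ Y i' ω t := le_antisymm (hi' i) (hi i')
  have h0 : 0 ≤ spectralFun ζ Y i ω t := (maxStable_eq_of_mem_argmaxSet hi ▸ hpos).le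
  have hQ := labelMeasure_forall_mem_eq 2 {i, i'} (fun n => if n = i then 0 else 1)
  have hQ0 : labelMeasure 2 {l | ∀ n ∈ ({i, i'} : Finset ℕ), l n = if n = i then 0 else 1} = 0 := by
    refine measure_mono_null (fun l hl => ?_) (ae_iff.1 hω)
    have e0 : l i = 0 := by simpa using hl i (by simp)
    have e1 : l i' = 1 := by simpa [Ne.symm hne] using hl i' (by simp)
    intro hall
    refine hall 0 1 (by decide) t ?_
    rw [← e0, ← e1, labelMax_eq_of_mem_argmaxSet hi h0,
      labelMax_eq_of_mem_argmaxSet hi' (hφ ▸ h0), hφ]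
  rw [hQ0] at hQ
  exact (pow_ne_zero _ (ENNReal.inv_ne_zero.2 (ENNReal.natCast_ne_top 2))) hQ.symm

/-- Almost surely, at every site the maximum is positive and attained by exactly one `φ_i`. -/
theorem IsSpectralSystem.ae_exists_argmax (hη : IsSpectralSystem P ζ Y) :
    ∀ᵐ ω ∂P, ∃ I : T → ℕ, ∀ t, argmaxSet ζ Y ω t = {I t} ∧ 0 < spectralFun ζ Y (I t) ω t := by
  filter_upwards [ae_all_iff.2 hη.ae_nonempty_argmaxSet, ae_all_iff.2 hη.ae_subsingleton_argmaxSet,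
    ae_all_iff.2 hη.ae_maxStable_pos] with ω h1 h2 h3
  choose I hI using h1
  refine ⟨I, fun t => ⟨(h2 t).eq_singleton_of_mem (hI t), ?_⟩⟩
  rw [← maxStable_eq_of_mem_argmaxSet (hI t)]
  exact h3 t

end Argmax

/-! ### The hitting scenario -/

section Hitting

variable {Ω : Type*} {k : ℕ} {ζ : ℕ → Ω → ℝ} {Y : ℕ → Ω → Fin k → ℝ}

theorem numComponents_eq_ncard {ω : Ω} {I : Fin k → ℕ}
    (hI : ∀ t, argmaxSet ζ Y ω t = {I t}) :
    numComponents ζ Y id ω = (Set.range I).ncard := by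
  have h1 : (fun j => argmaxSet ζ Y ω (id j)) = (fun i : ℕ => ({i} : Set ℕ)) ∘ I :=
    funext fun j => hI j
  rw [numComponents, hittingScenario, h1, Nat.card_congr (Setoid.quotientKerEquivRange _),
    Nat.card_coe_set_eq, Set.range_comp, Set.ncard_image_of_injective _ Set.singleton_injective]

theorem numComponents_pos [NeZero k] (ω : Ω) : 0 < numComponents ζ Y id ω := by
  have : Nonempty (Quotient (hittingScenario ζ Y id ω)) := ⟨Quotient.mk _ 0⟩
  exact Nat.card_pos

theorem numComponents_le (ω : Ω) : numComponents ζ Y id ω ≤ k := by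
  have := Nat.card_le_card_of_surjective (Quotient.mk (hittingScenario ζ Y id ω))
    Quotient.mk_surjective
  rwa [Nat.card_fin] at this

/-- There are m choices of the common label, each prescribing the labels of all distinct values of
I. The choices are disjoint events because there is at least one site. -/
theorem labelMeasure_exists_forall_eq (m : ℕ) [NeZero m] [NeZero k] (I : Fin k → ℕ) :
    labelMeasure m {l | ∃ a, ∀ t, l (I t) = a} = m * (m : ℝ≥0∞)⁻¹ ^ (Set.range I).ncard := by
  classical
  set S : Finset ℕ := Finset.univ.image I with hS
  have h1 : {l : ℕ → Fin m | ∃ a, ∀ t, l (I t) = a} = ⋃ a, {l | ∀ i ∈ S, l i = a} := by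
    ext l
    simp [hS]
  have h2 : (Set.range I).ncard = S.card := by
    rw [← Set.ncard_coe_finset]
    simp [hS]
  rw [h1, measure_iUnion]
  · simp_rw [fun a : Fin m => labelMeasure_forall_mem_eq m S fun _ => a]
    rw [tsum_fintype, Finset.sum_const, Finset.card_univ, Fintype.card_fin, nsmul_eq_mul, h2]
  · intro a b hab
    rw [Function.onFun, Set.disjoint_left]
    intro l hl hl'
    have hi : I 0 ∈ S := by simp [hS]
    exact hab ((hl _ hi).symm.trans (hl' _ hi))
  · intro a
    have : {l : ℕ → Fin m | ∀ i ∈ S, l i = a} = ⋂ i ∈ S, {l | l i = a} := by ext l; simp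
    rw [this]
    exact Finset.measurableSet_biInter _ fun i _ =>
      measurableSet_eq_fun (measurable_pi_apply i) measurable_const

/-- At site t the overall maximum is reached by the label of the maximizing function I t, and by no
other label since ties are excluded. -/
theorem exists_labelMax_le_iff {m : ℕ} {ω : Ω} {l : ℕ → Fin m} {I : Fin k → ℕ}
    (hI : ∀ t, argmaxSet ζ Y ω t = {I t} ∧ 0 < spectralFun ζ Y (I t) ω t)
    (hne : ∀ a b : Fin m, a ≠ b → ∀ t, labelMax ζ Y a (ω, l) t ≠ labelMax ζ Y b (ω, l) t) :
    (∃ a : Fin m, ∀ b t, labelMax ζ Y b (ω, l) t ≤ labelMax ζ Y a (ω, l) t) ↔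
      ∃ a, ∀ t, l (I t) = a := by
  have hmem : ∀ t, I t ∈ argmaxSet ζ Y ω t := fun t => by rw [(hI t).1]; rfl
  refine exists_congr fun a => ⟨fun h t => ?_, fun h b t => ?_⟩
  · by_contra hla
    refine hne _ _ hla t (le_antisymm (h _ t) ?_)
    rw [labelMax_eq_of_mem_argmaxSet (hmem t) (hI t).2.le]
    exact labelMax_le_of_mem_argmaxSet a (hmem t) (hI t).2.le
  · rw [← h t, labelMax_eq_of_mem_argmaxSet (hmem t) (hI t).2.le]
    exact labelMax_le_of_mem_argmaxSet b (hmem t) (hI t).2.le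

variable [MeasurableSpace Ω] {P : Measure Ω}

/-- There are finitely many equivalence relations on the sites, and agreement of two argmax sets is
a countable intersection of measurable events. -/
theorem IsSpectralSystem.measurable_numComponents (hη : IsSpectralSystem P ζ Y) :
    Measurable (numComponents ζ Y id) := by
  have : Finite (Setoid (Fin k)) :=
    Finite.of_injective (fun σ : Setoid (Fin k) => σ.r) fun σ τ h =>
      Setoid.ext fun a b => iff_of_eq (congrFun (congrFun h a) b)
  have hmem : ∀ i t, MeasurableSet {ω | i ∈ argmaxSet ζ Y ω t} := fun i t => by
    have : {ω | i ∈ argmaxSet ζ Y ω t}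
        = ⋂ l, {ω | spectralFun ζ Y l ω t ≤ spectralFun ζ Y i ω t} := by
      ext ω; simp [argmaxSet]
    rw [this]
    exact MeasurableSet.iInter fun l =>
      measurableSet_le (hη.measurable_spectralFun l t) (hη.measurable_spectralFun i t)
  have hrel : ∀ t t', MeasurableSet {ω | hittingScenario ζ Y id ω t t'} := fun t t' => by
    have : {ω | hittingScenario ζ Y id ω t t'}
        = ⋂ i, {ω | i ∈ argmaxSet ζ Y ω t ↔ i ∈ argmaxSet ζ Y ω t'} := by
      ext ω
      simp only [Set.mem_ofPred_eq, Set.mem_iInter]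
      exact Set.ext_iff
    rw [this]
    exact MeasurableSet.iInter fun i => (hmem i t).iff (hmem i t')
  refine measurable_to_countable' fun n => ?_
  have : numComponents ζ Y id ⁻¹' {n} = ⋃ σ : Setoid (Fin k),
      if Nat.card (Quotient σ) = n then
        ⋂ t, ⋂ t', {ω | hittingScenario ζ Y id ω t t' ↔ σ t t'} else ∅ := by
    ext ω
    simp only [Set.mem_preimage, Set.mem_singleton_iff, Set.mem_iUnion]
    constructor
    · intro h
      refine ⟨hittingScenario ζ Y id ω, ?_⟩
      rw [if_pos (show Nat.card (Quotient (hittingScenario ζ Y id ω)) = n from h)]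
      simp
    · rintro ⟨σ, hσ⟩
      split_ifs at hσ with h
      · have : hittingScenario ζ Y id ω = σ := by
          refine Setoid.ext fun t t' => ?_
          simp only [Set.mem_iInter] at hσ
          exact hσ t t'
        rw [numComponents, this, h]
      · exact hσ.elim
  rw [this]
  refine MeasurableSet.iUnion fun σ => ?_
  split_ifs
  · exact MeasurableSet.iInter fun t => MeasurableSet.iInter fun t' =>
      (hrel t t').iff (MeasurableSet.const _)
  · exact MeasurableSet.empty

/-- The vectors in `v`, one of which dominates all the others. -/
def concurrentSet (m k : ℕ) : Set (Fin m → Fin k → ℝ) := {v | ∃ a, ∀ b, v b ≤ v a}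

theorem measurableSet_concurrentSet (m k : ℕ) : MeasurableSet (concurrentSet m k) := by
  have : concurrentSet m k = ⋃ a, ⋂ b, {v | v b ≤ v a} := by
    ext v; simp [concurrentSet]
  rw [this]
  exact MeasurableSet.iUnion fun a => MeasurableSet.iInter fun b =>
    measurableSet_le (measurable_pi_apply b) (measurable_pi_apply a)

theorem IsSpectralSystem.pi_concurrentSet [IsProbabilityMeasure P] [NeZero k]
    (hη : IsSpectralSystem P ζ Y) (m : ℕ) [NeZero m] :
    (Measure.pi fun _ : Fin m => P.map (maxStable ζ Y)) (concurrentSet m k)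
      = ∫⁻ ω, m * (m : ℝ≥0∞)⁻¹ ^ numComponents ζ Y id ω ∂P := by
  have hm : (0 : ℝ) < m := Nat.cast_pos.2 (NeZero.pos m)
  have hLm : Measurable (fun (p : Ω × (ℕ → Fin m)) (a : Fin m) t => m * labelMax ζ Y a p t) :=
    measurable_pi_lambda _ fun a => measurable_pi_lambda _ fun t =>
      (hη.measurable_labelMax a t).const_mul _
  rw [← hη.map_labelMax, Measure.map_apply hLm (measurableSet_concurrentSet m k),
    Measure.prod_apply (hLm (measurableSet_concurrentSet m k))]
  refine lintegral_congr_ae ?_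
  filter_upwards [hη.ae_exists_argmax, Measure.ae_ae_of_ae_prod (hη.ae_labelMax_ne m)]
    with ω ⟨I, hI⟩ hne
  rw [numComponents_eq_ncard fun t => (hI t).1, ← labelMeasure_exists_forall_eq]
  refine measure_congr ?_
  filter_upwards [hne] with l hl
  refine propext ?_
  change (∃ a : Fin m, ∀ b t, m * labelMax ζ Y b (ω, l) t ≤ m * labelMax ζ Y a (ω, l) t) ↔
    ∃ a, ∀ t, l (I t) = a
  simp_rw [mul_le_mul_iff_right₀ hm]
  exact exists_labelMax_le_iff hI hl

/-- The probability that one of `m` independent copies of the max-stable vector dominates all the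
others is the expectation of `m ^ (1 - |π|)`. -/
theorem IsSpectralSystem.pi_real_concurrentSet [IsProbabilityMeasure P] [NeZero k]
    (hη : IsSpectralSystem P ζ Y) (m : ℕ) [NeZero m] :
    (Measure.pi fun _ : Fin m => P.map (maxStable ζ Y)).real (concurrentSet m k)
      = ∑ q ∈ Finset.range k, hittingProb ζ Y id P (q + 1) / (m : ℝ) ^ q := by
  have hm : (m : ℝ) ≠ 0 := Nat.cast_ne_zero.2 (NeZero.ne m)
  have hset : ∀ q, MeasurableSet {ω | numComponents ζ Y id ω = q} := fun q =>
    hη.measurable_numComponents (measurableSet_singleton q)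
  -- The index is q = |π| - 1, which runs over 0, …, k - 1, so that m · m^(-|π|) = m^(-q).
  have h1 : ∀ ω, (m : ℝ≥0∞) * (m : ℝ≥0∞)⁻¹ ^ numComponents ζ Y id ω
      = ∑ q ∈ Finset.range k, {ω | numComponents ζ Y id ω = q + 1}.indicator
        (fun _ => ENNReal.ofReal (1 / (m : ℝ) ^ q)) ω := by
    intro ω
    have hq := numComponents_pos (ζ := ζ) (Y := Y) ω
    have hk := numComponents_le (ζ := ζ) (Y := Y) ω
    rw [Finset.sum_eq_single (numComponents ζ Y id ω - 1)]
    · obtain ⟨q, hq'⟩ := Nat.exists_eq_succ_of_ne_zero hq.ne'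
      rw [Set.indicator_of_mem (by simp [hq'])]
      rw [hq', Nat.succ_eq_add_one, Nat.add_sub_cancel, pow_succ', ← mul_assoc,
        ENNReal.mul_inv_cancel (by exact_mod_cast NeZero.ne m) (ENNReal.natCast_ne_top m), one_mul,
        one_div, ENNReal.ofReal_inv_of_pos (by positivity [NeZero.pos m]),
        ENNReal.ofReal_pow (by positivity), ENNReal.ofReal_natCast, ENNReal.inv_pow]
    · intro q _ hne
      refine Set.indicator_of_notMem (fun h => hne ?_) _
      have h' : numComponents ζ Y id ω = q + 1 := h
      omega
    · intro h
      exact absurd (Finset.mem_range.2 (by omega)) h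
  rw [measureReal_def, hη.pi_concurrentSet m]
  simp_rw [h1]
  rw [lintegral_finsetSum _ fun q _ => measurable_const.indicator (hset _)]
  simp_rw [fun q => lintegral_indicator_const (μ := P) (hset (q + 1))]
  rw [ENNReal.toReal_sum fun q _ => ENNReal.mul_ne_top ENNReal.ofReal_ne_top (measure_ne_top _ _)]
  refine Finset.sum_congr rfl fun q _ => ?_
  rw [ENNReal.toReal_mul, ENNReal.toReal_ofReal (by positivity), hittingProb, measureReal_def]
  ring

/-- Take m = 1 in the identity: a single vector always dominates. -/
theorem IsSpectralSystem.sum_hittingProb [IsProbabilityMeasure P] [NeZero k]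
    (hη : IsSpectralSystem P ζ Y) : ∑ q ∈ Finset.range k, hittingProb ζ Y id P (q + 1) = 1 := by
  have h := hη.pi_real_concurrentSet 1
  have h1 : concurrentSet 1 k = Set.univ := by
    refine Set.eq_univ_of_forall fun v => ⟨0, fun b => ?_⟩
    rw [Subsingleton.elim b 0]
  have : IsProbabilityMeasure (P.map (maxStable ζ Y)) :=
    Measure.isProbabilityMeasure_map
      (measurable_pi_lambda _ fun t => hη.measurable_maxStable t).aemeasurable
  rw [h1, probReal_univ] at h
  simpa using h.symm

/-- With one component a single φ_i is maximal at every site. This inequality suffices to make the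
term q = 0 vanish when p = 0. -/
theorem IsSpectralSystem.hittingProb_one_le [IsProbabilityMeasure P] [NeZero k]
    (hη : IsSpectralSystem P ζ Y) :
    hittingProb ζ Y id P 1 ≤ extremalConcurrenceProb ζ Y id P := by
  rw [hittingProb, extremalConcurrenceProb, measureReal_def, measureReal_def]
  refine ENNReal.toReal_mono (measure_ne_top _ _) (measure_mono_ae ?_)
  filter_upwards [hη.ae_exists_argmax] with ω ⟨I, hI⟩ h1
  have h2 : numComponents ζ Y id ω = 1 := h1
  rw [numComponents_eq_ncard fun t => (hI t).1, Set.ncard_eq_one] at h2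
  obtain ⟨i, hi⟩ := h2
  refine ⟨i, fun t => maxStable_eq_of_mem_argmaxSet ?_⟩
  have : I t ∈ Set.range I := ⟨t, rfl⟩
  rw [hi] at this
  rw [id, (hI t).1]
  exact this.symm

end Hitting

/-! ### Poisson limit of the number of concurrent blocks -/

/-- Since N → ∞ and N w converges, w → 0 and N log(1 + w) = N w + O(N w²), where the error tends to
0. -/
theorem tendsto_one_add_pow_exp {N : ℕ → ℕ} {w : ℕ → ℂ} {z : ℂ} (hN : Tendsto N atTop atTop)
    (hw : Tendsto (fun n => N n * w n) atTop (𝓝 z)) :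
    Tendsto (fun n => (1 + w n) ^ N n) atTop (𝓝 (Complex.exp z)) := by
  have hw0 : Tendsto w atTop (𝓝 0) := by
    have h1 : Tendsto (fun n => ((N n : ℂ))⁻¹) atTop (𝓝 0) :=
      (tendsto_inv_atTop_nhds_zero_nat (𝕜 := ℂ)).comp hN
    have h2 := h1.mul hw
    rw [zero_mul] at h2
    refine h2.congr' ?_
    filter_upwards [hN.eventually_gt_atTop 0] with n hn
    have : (N n : ℂ) ≠ 0 := by exact_mod_cast hn.ne'
    field_simp
  have h1 : Tendsto (fun n => N n * (Complex.log (1 + w n) - w n)) atTop (𝓝 0) := by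
    have h2 : (fun n => N n * (Complex.log (1 + w n) - w n)) =O[atTop]
        fun n => (N n : ℂ) * w n ^ 2 :=
      (Asymptotics.isBigO_refl _ _).mul (Complex.log_sub_self_isBigO.comp_tendsto hw0)
    refine h2.trans_tendsto ?_
    have h3 := hw.mul hw0
    rw [mul_zero] at h3
    refine h3.congr fun n => ?_
    ring
  have h2 : Tendsto (fun n => N n * Complex.log (1 + w n)) atTop (𝓝 z) := by
    have := h1.add hw
    rw [zero_add] at this
    refine this.congr fun n => ?_
    ring
  refine ((Complex.continuous_exp.tendsto _).comp h2).congr' ?_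
  filter_upwards [hw0.eventually_ne (show (0 : ℂ) ≠ -1 by simp)] with n hn
  have h3 : 1 + w n ≠ 0 := fun h => hn (by linear_combination h)
  rw [Function.comp, Complex.exp_nat_mul, Complex.exp_log h3]

/-! ### Block indicators and the estimator. -/

section Sample

variable {Ω : Type*} {k : ℕ} {X : ℕ → Ω → Fin k → ℝ}

theorem blockIndicator_eq_indicator (m b : ℕ) (ω : Ω) :
    blockIndicator X m b ω =
      {ω | (fun i : Fin m => X (b * m + i) ω) ∈ concurrentSet m k}.indicator 1 ω := by
  classical
  rw [blockIndicator, Set.indicator_apply]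
  exact if_congr Iff.rfl rfl rfl

theorem estimator_ne_zero_subset (n m : ℕ) :
    {ω | estimator X n m ω ≠ 0} ⊆ ⋃ b ∈ Finset.range (n / m),
      {ω | (fun i : Fin m => X (b * m + i) ω) ∈ concurrentSet m k} := by
  intro ω hω
  by_contra h
  simp only [Set.mem_iUnion, not_exists] at h
  refine hω ?_
  rw [estimator, Finset.sum_eq_zero, mul_zero]
  intro b hb
  rw [blockIndicator_eq_indicator]
  exact Set.indicator_of_notMem (h b hb) _

variable [MeasurableSpace Ω]

theorem measurable_block (hX : ∀ i, Measurable (X i)) (m b : ℕ) :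
    Measurable (fun ω (i : Fin m) => X (b * m + i) ω) :=
  measurable_pi_lambda _ fun _ => hX _

theorem measurableSet_blockConcurrence (hX : ∀ i, Measurable (X i)) (m b : ℕ) :
    MeasurableSet {ω | (fun i : Fin m => X (b * m + i) ω) ∈ concurrentSet m k} :=
  measurable_block hX m b (measurableSet_concurrentSet m k)

theorem measurable_blockIndicator (hX : ∀ i, Measurable (X i)) (m b : ℕ) :
    Measurable (blockIndicator X m b) := by
  have : blockIndicator X m b = _ := funext (blockIndicator_eq_indicator (X := X) m b)
  rw [this]
  exact measurable_one.indicator (measurableSet_blockConcurrence hX m b)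

theorem measurable_estimator (hX : ∀ i, Measurable (X i)) (n m : ℕ) :
    Measurable (estimator X n m) :=
  (Finset.measurable_sum _ fun b _ => measurable_blockIndicator hX m b).const_mul _

variable {P : Measure Ω} {ν : Measure (Fin k → ℝ)}

theorem map_block_eq_pi (hX : ∀ i, Measurable (X i)) (hind : iIndepFun X P)
    (hν : ∀ i, P.map (X i) = ν) (m b : ℕ) :
    P.map (fun ω (i : Fin m) => X (b * m + i) ω) = Measure.pi fun _ => ν := by
  have hinj : Function.Injective (fun i : Fin m => b * m + (i : ℕ)) := fun i j h =>
    Fin.ext (Nat.add_left_cancel h)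
  have := (hind.precomp hinj).map_fun_eq_pi_map fun i => (hX _).aemeasurable
  simpa [hν] using this

theorem measureReal_blockConcurrence (hX : ∀ i, Measurable (X i)) (hind : iIndepFun X P)
    (hν : ∀ i, P.map (X i) = ν) (m b : ℕ) :
    P.real {ω | (fun i : Fin m => X (b * m + i) ω) ∈ concurrentSet m k}
      = (Measure.pi fun _ : Fin m => ν).real (concurrentSet m k) := by
  rw [← map_block_eq_pi hX hind hν m b, measureReal_def, measureReal_def,
    Measure.map_apply (measurable_block hX m b) (measurableSet_concurrentSet m k)]
  rfl

theorem sampleConcurrenceProb_eq (hX : ∀ i, Measurable (X i)) (hind : iIndepFun X P)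
    (hν : ∀ i, P.map (X i) = ν) (m : ℕ) :
    sampleConcurrenceProb X P m = (Measure.pi fun _ : Fin m => ν).real (concurrentSet m k) := by
  rw [← measureReal_blockConcurrence hX hind hν m 0, sampleConcurrenceProb]
  congr 1
  ext ω
  simp only [concurrentSet, zero_mul, zero_add, Set.mem_ofPred_eq]
  refine exists_congr fun l => ⟨fun h i j => ?_, fun h j => ?_⟩
  · rw [← h j]
    exact le_ciSup (f := fun i : Fin m => X i ω j) (Set.finite_range _).bddAbove i
  · have : Nonempty (Fin m) := ⟨l⟩
    exact le_antisymm (ciSup_le fun i => h i j)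
      (le_ciSup (f := fun i : Fin m => X i ω j) (Set.finite_range _).bddAbove l)

theorem indepFun_sum_blockIndicator (hX : ∀ i, Measurable (X i)) (hind : iIndepFun X P)
    (m N : ℕ) :
    IndepFun (fun ω => ∑ b ∈ Finset.range N, blockIndicator X m b ω)
      (blockIndicator X m N) P := by
  classical
  -- Extension by zero lets block indicators be read as functions of the finitely many vectors in S,
  -- so that independence over disjoint finite index sets applies.
  set ext : (S : Finset ℕ) → (S → Fin k → ℝ) → ℕ → Fin k → ℝ :=
    fun S v i => if h : i ∈ S then v ⟨i, h⟩ else 0 with hext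
  have hextm : ∀ S i, Measurable (fun v => ext S v i) := fun S i => by
    by_cases h : i ∈ S
    · simp only [hext, h, dite_true]
      exact measurable_pi_apply _
    · simp only [hext, h, dite_false]
      exact measurable_const
  have hblock : ∀ (S : Finset ℕ) (b : ℕ) (ω : Ω), (∀ i < m, b * m + i ∈ S) →
      blockIndicator (fun i v => ext S v i) m b (fun i : S => X i ω) = blockIndicator X m b ω := by
    intro S b ω hS
    have h1 : ∀ i : Fin m, ext S (fun i : S => X i ω) (b * m + i) = X (b * m + i) ω := fun i => by
      simp only [hext, hS i i.2, dite_true]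
    simp only [blockIndicator, h1]
  have h1 := hind.indepFun_finset (Finset.range (N * m)) (Finset.Ico (N * m) (N * m + m))
    (by
      rw [Finset.disjoint_left]
      intro i hi hi'
      rw [Finset.mem_range] at hi
      rw [Finset.mem_Ico] at hi'
      omega) hX
  have h2 := h1.comp
    (φ := fun v => ∑ b ∈ Finset.range N, blockIndicator (fun i v => ext _ v i) m b v)
    (ψ := blockIndicator (fun i v => ext _ v i) m N)
    (Finset.measurable_sum _ fun b _ => measurable_blockIndicator (hextm _) m b)
    (measurable_blockIndicator (hextm _) m N)
  convert! h2 using 1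
  · ext ω
    refine Finset.sum_congr rfl fun b hb => (hblock _ b ω fun i hi => ?_).symm
    rw [Finset.mem_range] at hb ⊢
    calc b * m + i < b * m + m := by omega
      _ = (b + 1) * m := by ring
      _ ≤ N * m := Nat.mul_le_mul_right _ hb
  · ext ω
    refine (hblock _ N ω fun i hi => ?_).symm
    rw [Finset.mem_Ico]
    omega

variable [IsProbabilityMeasure P]

theorem charFun_map_blockIndicator (hX : ∀ i, Measurable (X i)) (hind : iIndepFun X P)
    (hν : ∀ i, P.map (X i) = ν) (m b : ℕ) (u : ℝ) :
    charFun (P.map (blockIndicator X m b)) u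
      = 1 + sampleConcurrenceProb X P m * (Complex.exp (u * Complex.I) - 1) := by
  set A := {ω | (fun i : Fin m => X (b * m + i) ω) ∈ concurrentSet m k} with hA
  have hAm : MeasurableSet A := measurableSet_blockConcurrence hX m b
  rw [charFun_apply_real, integral_map (measurable_blockIndicator hX m b).aemeasurable
    (Measurable.aestronglyMeasurable (by fun_prop)), sampleConcurrenceProb_eq hX hind hν,
    ← measureReal_blockConcurrence hX hind hν m b]
  have h1 : ∀ ω, Complex.exp (u * (blockIndicator X m b ω : ℝ) * Complex.I)
      = 1 + A.indicator (fun _ => Complex.exp (u * Complex.I) - 1) ω := by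
    intro ω
    rw [blockIndicator_eq_indicator]
    by_cases h : ω ∈ A
    · rw [Set.indicator_of_mem h, Set.indicator_of_mem h]
      simp
    · rw [Set.indicator_of_notMem h, Set.indicator_of_notMem h]
      simp
  simp_rw [h1]
  rw [integral_add (integrable_const _) ((integrable_const _).indicator hAm),
    integral_indicator_const _ hAm, integral_const, probReal_univ, one_smul, Complex.real_smul]

theorem charFun_map_sum_blockIndicator (hX : ∀ i, Measurable (X i)) (hind : iIndepFun X P)
    (hν : ∀ i, P.map (X i) = ν) (m N : ℕ) (u : ℝ) :
    charFun (P.map fun ω => ∑ b ∈ Finset.range N, blockIndicator X m b ω) u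
      = (1 + sampleConcurrenceProb X P m * (Complex.exp (u * Complex.I) - 1)) ^ N := by
  induction N with
  | zero => simp
  | succ N ih =>
    have h1 := (indepFun_sum_blockIndicator hX hind m N).charFun_map_add_eq_mul
      (Finset.measurable_sum _ fun b _ => measurable_blockIndicator hX m b).aemeasurable
      (measurable_blockIndicator hX m N).aemeasurable
    have h2 : (fun ω => ∑ b ∈ Finset.range (N + 1), blockIndicator X m b ω)
        = (fun ω => ∑ b ∈ Finset.range N, blockIndicator X m b ω) + blockIndicator X m N := by
      ext ω
      simp [Finset.sum_range_succ]
    rw [h2, h1, Pi.mul_apply, ih, charFun_map_blockIndicator hX hind hν, pow_succ]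

theorem charFun_map_mul_estimator (hX : ∀ i, Measurable (X i)) (hind : iIndepFun X P)
    (hν : ∀ i, P.map (X i) = ν) (n m : ℕ) (x t : ℝ) :
    charFun (P.map fun ω => x * estimator X n m ω) t
      = (1 + sampleConcurrenceProb X P m *
        (Complex.exp ((x / (n / m : ℕ) * t : ℝ) * Complex.I) - 1)) ^ (n / m) := by
  rw [← charFun_map_sum_blockIndicator hX hind hν, ← charFun_map_mul_comp
    (Finset.measurable_sum _ fun b _ => measurable_blockIndicator hX m b).aemeasurable]
  congr 3
  ext ω
  rw [estimator]
  ring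

theorem natDiv_eq_floor (n m : ℕ) : n / m = ⌊(n : ℝ) / m⌋₊ := (Nat.floor_div_eq_div n m).symm

theorem tendstoInDistribution_estimator (hX : ∀ i, Measurable (X i)) (hind : iIndepFun X P)
    (hν : ∀ i, P.map (X i) = ν) {m : ℕ → ℕ} {κ : ℝ} (hκ : 0 ≤ κ)
    (hm : Tendsto (fun n : ℕ => (n : ℝ) / (m n : ℝ)) atTop atTop)
    (hp : Tendsto (fun n : ℕ => (n : ℝ) / m n * sampleConcurrenceProb X P (m n)) atTop (𝓝 κ)) :
    TendstoInDistribution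
      (fun (n : ℕ) (ω : Ω) => (n : ℝ) / (m n : ℝ) * estimator X n (m n) ω) atTop
      (fun q : ℕ => (q : ℝ)) (fun _ => P) (poissonMeasure (Real.toNNReal κ)) where
  forall_aemeasurable n := ((measurable_estimator hX n (m n)).const_mul _).aemeasurable
  aemeasurable_limit := by fun_prop
  tendsto := by
    refine ProbabilityMeasure.tendsto_iff_tendsto_charFun.2 fun t => ?_
    simp only [ProbabilityMeasure.coe_mk]
    rw [charFun_map_cast_poissonMeasure]
    simp_rw [charFun_map_mul_estimator hX hind hν]
    refine tendsto_one_add_pow_exp ?_ ?_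
    · simp_rw [natDiv_eq_floor]
      exact tendsto_nat_floor_atTop.comp hm
    -- The normalization is n/m while the number of blocks is [n/m]. The ratio tends to 1 and only
    -- perturbs the argument of the characteristic function.
    have h1 : Tendsto (fun n : ℕ => ((n / m n : ℕ) : ℝ) / ((n : ℝ) / m n)) atTop (𝓝 1) := by
      simp_rw [natDiv_eq_floor]
      exact tendsto_nat_floor_div_atTop.comp hm
    have h2 : Tendsto (fun n : ℕ => ((n : ℝ) / m n) / (n / m n : ℕ)) atTop (𝓝 1) := by
      simpa using h1.inv₀ one_ne_zero
    have h3 : Tendsto (fun n : ℕ => ((n / m n : ℕ) : ℝ) * sampleConcurrenceProb X P (m n)) atTop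
        (𝓝 κ) := by
      have := h1.mul hp
      rw [one_mul] at this
      refine this.congr' ?_
      filter_upwards [hm.eventually_gt_atTop 0] with n hn
      rw [← mul_assoc, div_mul_cancel₀ _ hn.ne']
    have h4 : Tendsto (fun n : ℕ =>
        Complex.exp (((n : ℝ) / m n / (n / m n : ℕ) * t : ℝ) * Complex.I) - 1) atTop
        (𝓝 (Complex.exp (t * Complex.I) - 1)) := by
      have hc : Continuous (fun x : ℝ => Complex.exp ((x * t : ℝ) * Complex.I) - 1) := by fun_prop
      have := (hc.tendsto 1).comp h2
      rw [one_mul] at this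
      exact this
    have h5 := ((Complex.continuous_ofReal.tendsto _).comp h3).mul h4
    rw [Real.coe_toNNReal κ hκ]
    refine h5.congr fun n => ?_
    simp only [Function.comp]
    push_cast
    ring

theorem measureReal_estimator_ne_zero_le (hX : ∀ i, Measurable (X i)) (hind : iIndepFun X P)
    (hν : ∀ i, P.map (X i) = ν) (n m : ℕ) :
    P.real {ω | estimator X n m ω ≠ 0} ≤ (n : ℝ) / m * sampleConcurrenceProb X P m := by
  calc P.real {ω | estimator X n m ω ≠ 0}
      ≤ P.real (⋃ b ∈ Finset.range (n / m),
        {ω | (fun i : Fin m => X (b * m + i) ω) ∈ concurrentSet m k}) :=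
        measureReal_mono (estimator_ne_zero_subset n m) (measure_ne_top _ _)
    _ ≤ ∑ b ∈ Finset.range (n / m),
        P.real {ω | (fun i : Fin m => X (b * m + i) ω) ∈ concurrentSet m k} :=
        measureReal_biUnion_finset_le _ _
    _ = ((n / m : ℕ) : ℝ) * sampleConcurrenceProb X P m := by
        simp_rw [measureReal_blockConcurrence hX hind hν, ← sampleConcurrenceProb_eq hX hind hν]
        simp
    _ ≤ (n : ℝ) / m * sampleConcurrenceProb X P m :=
        mul_le_mul_of_nonneg_right Nat.cast_div_le measureReal_nonneg

theorem tendsto_measureReal_estimator_ne_zero (hX : ∀ i, Measurable (X i)) (hind : iIndepFun X P)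
    (hν : ∀ i, P.map (X i) = ν) {m : ℕ → ℕ}
    (hp : Tendsto (fun n : ℕ => (n : ℝ) / m n * sampleConcurrenceProb X P (m n)) atTop (𝓝 0)) :
    Tendsto (fun n => P.real {ω | estimator X n (m n) ω ≠ 0}) atTop (𝓝 0) :=
  squeeze_zero (fun _ => measureReal_nonneg)
    (fun n => measureReal_estimator_ne_zero_le hX hind hν n (m n)) hp

theorem tendsto_measureReal_estimator_eq_zero (hX : ∀ i, Measurable (X i)) (hind : iIndepFun X P)
    (hν : ∀ i, P.map (X i) = ν) {m : ℕ → ℕ}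
    (hp : Tendsto (fun n : ℕ => (n : ℝ) / m n * sampleConcurrenceProb X P (m n)) atTop (𝓝 0)) :
    Tendsto (fun n => P.real {ω | estimator X n (m n) ω = 0}) atTop (𝓝 1) := by
  have h := (tendsto_measureReal_estimator_ne_zero hX hind hν hp).const_sub 1
  rw [sub_zero] at h
  refine h.congr fun n => ?_
  have hS : MeasurableSet {ω | estimator X n (m n) ω = 0} :=
    measurableSet_eq_fun (measurable_estimator hX n (m n)) measurable_const
  have h1 := probReal_compl_eq_one_sub (μ := P) hS
  have h2 : {ω | estimator X n (m n) ω = 0}ᶜ = {ω | estimator X n (m n) ω ≠ 0} := rfl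
  rw [← h2, h1]
  ring

/-- A multiple of the estimator is nonzero only where the estimator is, so no growth condition on
`a` is needed. -/
theorem tendstoInMeasure_mul_estimator (hX : ∀ i, Measurable (X i)) (hind : iIndepFun X P)
    (hν : ∀ i, P.map (X i) = ν) {m : ℕ → ℕ}
    (hp : Tendsto (fun n : ℕ => (n : ℝ) / m n * sampleConcurrenceProb X P (m n)) atTop (𝓝 0))
    (a : ℕ → ℝ) :
    TendstoInMeasure P (fun (n : ℕ) (ω : Ω) => a n * estimator X n (m n) ω) atTop
      (fun _ => 0) := by
  intro ε hε
  have h := ENNReal.tendsto_ofReal (tendsto_measureReal_estimator_ne_zero hX hind hν hp)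
  rw [ENNReal.ofReal_zero] at h
  refine tendsto_of_tendsto_of_tendsto_of_le_of_le tendsto_const_nhds h (fun _ => zero_le)
    fun n => ?_
  rw [ofReal_measureReal]
  refine measure_mono fun ω hω => ?_
  change estimator X n (m n) ω ≠ 0
  intro h0
  have hω' : ε ≤ edist (a n * estimator X n (m n) ω) 0 := hω
  rw [h0, mul_zero, edist_self] at hω'
  exact absurd hε (not_lt.2 hω')

end Sample

/-! ### Asymptotics of the sample concurrence probability -/

/-- Dominance depends only on the order of the coordinates. Both sides are pulled back to m copies
of Ω, where all coordinates are a.s. positive and each h j preserves their order. -/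
theorem pi_real_concurrentSet_comp {Ω : Type*} [MeasurableSpace Ω] {P : Measure Ω}
    [IsProbabilityMeasure P] {k : ℕ} {f : Ω → Fin k → ℝ} (hf : Measurable f)
    (hpos : ∀ᵐ ω ∂P, ∀ j, 0 < f ω j) {h : Fin k → ℝ → ℝ}
    (hh : ∀ j, StrictMonoOn (h j) (Set.Ioi 0)) (hhf : AEMeasurable (fun ω j => h j (f ω j)) P)
    (m : ℕ) :
    (Measure.pi fun _ : Fin m => P.map fun ω j => h j (f ω j)).real (concurrentSet m k)
      = (Measure.pi fun _ : Fin m => P.map f).real (concurrentSet m k) := by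
  have : IsProbabilityMeasure (P.map fun ω j => h j (f ω j)) :=
    Measure.isProbabilityMeasure_map hhf
  have : IsProbabilityMeasure (P.map f) := Measure.isProbabilityMeasure_map hf.aemeasurable
  have hC := measurableSet_concurrentSet m k
  have e1 : ∀ g : Ω → Fin k → ℝ, AEMeasurable g P →
      (Measure.pi fun _ : Fin m => P.map g) (concurrentSet m k)
      = (Measure.pi fun _ : Fin m => P) {x | (fun i => g (x i)) ∈ concurrentSet m k} := by
    intro g hg
    have : IsProbabilityMeasure (P.map g) := Measure.isProbabilityMeasure_map hg
    rw [← Measure.pi_map_pi fun _ => hg, Measure.map_apply_of_aemeasurable ?_ hC]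
    · rfl
    · exact aemeasurable_pi_lambda _ fun i =>
        hg.comp_quasiMeasurePreserving (Measure.quasiMeasurePreserving_eval _ i)
  rw [measureReal_def, measureReal_def, e1 _ hhf, e1 _ hf.aemeasurable]
  congr 1
  refine measure_congr ?_
  have hpos' : ∀ᵐ x ∂(Measure.pi fun _ : Fin m => P), ∀ i j, 0 < f (x i) j :=
    ae_all_iff.2 fun i => (Measure.quasiMeasurePreserving_eval (fun _ : Fin m => P) i).ae hpos
  filter_upwards [hpos'] with x hx
  refine propext ?_
  change (∃ a, ∀ b j, h j (f (x b) j) ≤ h j (f (x a) j)) ↔ ∃ a, ∀ b j, f (x b) j ≤ f (x a) j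
  simp_rw [fun j a b => (hh j).le_iff_le (Set.mem_Ioi.2 (hx b j)) (Set.mem_Ioi.2 (hx a j))]

theorem tendsto_pow_mul_sum_div_pow {k r : ℕ} (hr : r < k) {c : ℕ → ℝ} (hc : ∀ q < r, c q = 0) :
    Tendsto (fun m : ℕ => (m : ℝ) ^ r * ∑ q ∈ Finset.range k, c q / (m : ℝ) ^ q) atTop
      (𝓝 (c r)) := by
  have h1 : ∀ q ∈ Finset.range k, Tendsto (fun m : ℕ => (m : ℝ) ^ r * (c q / (m : ℝ) ^ q)) atTop
      (𝓝 (if q = r then c r else 0)) := by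
    intro q _
    rcases lt_trichotomy q r with hq | rfl | hq
    · simp [hc q hq, hq.ne]
    · rw [if_pos rfl]
      refine tendsto_const_nhds.congr' ?_
      filter_upwards [eventually_gt_atTop 0] with m hm
      have : (m : ℝ) ≠ 0 := by positivity
      field_simp
    · rw [if_neg hq.ne']
      obtain ⟨d, rfl⟩ := Nat.exists_eq_add_of_lt hq
      have h2 : Tendsto (fun m : ℕ => c (r + d + 1) / (m : ℝ) ^ (d + 1)) atTop (𝓝 0) :=
        tendsto_const_nhds.div_atTop ((tendsto_pow_atTop (Nat.succ_ne_zero d)).comp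
          tendsto_natCast_atTop_atTop)
      refine h2.congr' ?_
      filter_upwards [eventually_gt_atTop 0] with m hm
      have : (m : ℝ) ≠ 0 := by positivity
      rw [add_assoc r d 1, pow_add (m : ℝ) r (d + 1)]
      field_simp
  have h2 := tendsto_finsetSum (Finset.range k) h1
  rw [Finset.sum_ite_eq', if_pos (Finset.mem_range.2 hr)] at h2
  refine h2.congr fun m => ?_
  rw [Finset.mul_sum]

/-- (n/m) p_m = (m^r p_m) · (n^(1/(r+1)) / m)^(r+1). Working with the limit ℓ of the inverse ratio
treats ℓ = 1/λ and ℓ = 0 together. -/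
theorem tendsto_div_mul_of_tendsto_pow_mul {p : ℕ → ℝ} {r : ℕ} {c ℓ : ℝ}
    (hp : Tendsto (fun m : ℕ => (m : ℝ) ^ r * p m) atTop (𝓝 c)) {m : ℕ → ℕ}
    (hm : Tendsto m atTop atTop)
    (hℓ : Tendsto (fun n : ℕ => ((m n : ℝ) / (n : ℝ) ^ (1 / ((r : ℝ) + 1)))⁻¹) atTop (𝓝 ℓ)) :
    Tendsto (fun n : ℕ => (n : ℝ) / m n * p (m n)) atTop (𝓝 (c * ℓ ^ (r + 1))) := by
  have h1 := (hp.comp hm).mul (hℓ.pow (r + 1))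
  refine h1.congr' ?_
  filter_upwards [hm.eventually_gt_atTop 0] with n hn
  have hn' : (m n : ℝ) ≠ 0 := by positivity
  have h2 : ((n : ℝ) ^ (1 / ((r : ℝ) + 1))) ^ (r + 1) = n := by
    rw [← Real.rpow_natCast, ← Real.rpow_mul (Nat.cast_nonneg n)]
    push_cast
    rw [one_div_mul_cancel (by positivity), Real.rpow_one]
  simp only [Function.comp]
  rw [inv_div, div_pow, h2, pow_succ]
  field_simp

/-- The restriction of a spectral system to finitely many sites. -/
theorem IsSpectralSystem.comp_sites {Ω T : Type*} [MeasurableSpace Ω] [TopologicalSpace T]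
    {P : Measure Ω} {ζ : ℕ → Ω → ℝ} {Y : ℕ → Ω → T → ℝ} (hη : IsSpectralSystem P ζ Y) {k : ℕ}
    (s : Fin k → T) : IsSpectralSystem P ζ (fun i ω j => Y i ω (s j)) := by
  have hs : Measurable (fun (w : T → ℝ) (j : Fin k) => w (s j)) :=
    measurable_pi_lambda _ fun j => measurable_pi_apply (s j)
  refine ⟨hη.poisson, fun i => hs.comp (hη.measurable i), fun i ω j => hη.nonneg i ω (s j),
    fun i ω => continuous_of_discreteTopology, fun i => (hη.identDistrib i).comp hs,
    hη.indep.comp (fun _ w j => w (s j)) fun _ => hs, ?_, fun j => hη.mean_eq_one (s j), ?_⟩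
  · refine hη.indep_poisson.comp (ψ := fun (v : ℕ → T → ℝ) i j => v i (s j)) measurable_id ?_
    exact measurable_pi_lambda _ fun i => hs.comp (measurable_pi_apply i)
  · refine lt_of_le_of_lt (lintegral_mono fun ω => ?_) hη.mean_sup_lt_top
    exact iSup_comp_le (fun t => ENNReal.ofReal (Y 0 ω t)) s

theorem IsSpectralSystem.sampleConcurrenceProb_eq_sum {Ω : Type*} [MeasurableSpace Ω]
    {P : Measure Ω} [IsProbabilityMeasure P] {k : ℕ} [NeZero k] {ζ : ℕ → Ω → ℝ}
    {Y : ℕ → Ω → Fin k → ℝ} (hη : IsSpectralSystem P ζ Y) {h : Fin k → ℝ → ℝ}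
    (hh : ∀ j, StrictMonoOn (h j) (Set.Ioi 0)) {Ω' : Type*} [MeasurableSpace Ω']
    {P' : Measure Ω'} {X : ℕ → Ω' → Fin k → ℝ} (hXm : ∀ i, Measurable (X i))
    (hXindep : iIndepFun X P')
    (hXlaw : ∀ i, IdentDistrib (X i) (fun ω j => h j (maxStable ζ Y ω j)) P' P)
    {m : ℕ} (hm : m ≠ 0) :
    sampleConcurrenceProb X P' m
      = ∑ q ∈ Finset.range k, hittingProb ζ Y id P (q + 1) / (m : ℝ) ^ q := by
  have : NeZero m := ⟨hm⟩
  rw [← hη.pi_real_concurrentSet m, sampleConcurrenceProb_eq hXm hXindep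
    (fun i => (hXlaw i).map_eq) m]
  exact pi_real_concurrentSet_comp (measurable_pi_lambda _ fun t => hη.measurable_maxStable t)
    (ae_all_iff.2 hη.ae_maxStable_pos) hh (hXlaw 0).aemeasurable_snd m

end Concurrence

/-! ### The main theorem. -/

theorem theorem6 {d k : ℕ} (hk : 2 ≤ k)
    {𝒳 : Set (EuclideanSpace ℝ (Fin d))} (h𝒳 : IsCompact 𝒳) (s : Fin k → 𝒳)
    -- the max-stable process `η = maxStable ζ Y`
    {Ω : Type*} [MeasurableSpace Ω] (P : Measure Ω) [IsProbabilityMeasure P]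
    (ζ : ℕ → Ω → ℝ) (Y : ℕ → Ω → 𝒳 → ℝ) (hη : IsSpectralSystem P ζ Y)
    -- the sample: independent copies of `(h_1(η(s_1)), …, h_k(η(s_k)))`
    (h : Fin k → ℝ → ℝ) (hh : ∀ j, StrictMonoOn (h j) (Set.Ioi 0))
    {Ω' : Type*} [MeasurableSpace Ω'] (P' : Measure Ω') [IsProbabilityMeasure P']
    (X : ℕ → Ω' → Fin k → ℝ) (hXm : ∀ i, Measurable (X i)) (hXindep : iIndepFun X P')
    (hXlaw : ∀ i, IdentDistrib (X i) (fun ω j => h j (maxStable ζ Y ω (s j))) P' P)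
    (hp : extremalConcurrenceProb ζ Y s P = 0)
    (r : ℕ) (hr : r = biasExponent ζ Y s P) (c : ℝ) (hc : c = biasConst ζ Y s P) :
    -- the constants `r` and `c = c_r` are those of the expansion of `p_m - p`
    (1 ≤ r ∧ r ≤ k - 1 ∧ 0 < c ∧ c ≤ 1 - extremalConcurrenceProb ζ Y s P ∧
      Asymptotics.IsEquivalent atTop
        (fun m : ℕ => sampleConcurrenceProb X P' m - extremalConcurrenceProb ζ Y s P)
        (fun m : ℕ => c / (m : ℝ) ^ r)) ∧
    ∀ m : ℕ → ℕ, Tendsto (fun n : ℕ => (n : ℝ) / (m n : ℝ)) atTop atTop →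
      -- the case `λ < ∞`
      (∀ lam : ℝ, 0 < lam →
        Tendsto (fun n : ℕ => (m n : ℝ) / (n : ℝ) ^ (1 / ((r : ℝ) + 1))) atTop (𝓝 lam) →
        TendstoInDistribution
          (fun (n : ℕ) (ω : Ω') => (n : ℝ) / (m n : ℝ) * estimator X n (m n) ω) atTop
          (fun q : ℕ => (q : ℝ)) (fun _ => P')
          (poissonMeasure (Real.toNNReal (c / lam ^ (r + 1))))) ∧
      -- the case `λ = ∞`
      (Tendsto (fun n : ℕ => (m n : ℝ) / (n : ℝ) ^ (1 / ((r : ℝ) + 1))) atTop atTop →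
        Tendsto (fun n : ℕ => P'.real {ω | estimator X n (m n) ω = 0}) atTop (𝓝 1) ∧
        ∀ a : ℕ → ℝ, (∀ n, 0 < a n) →
          TendstoInMeasure P' (fun (n : ℕ) (ω : Ω') => a n * estimator X n (m n) ω) atTop
            (fun _ => 0)) := by
  have : NeZero k := ⟨by omega⟩
  -- Only the values at the k sites matter; with a finite index set, almost sure statements hold at
  -- all sites at once.
  have hη' := hη.comp_sites s
  have hp_sum : ∀ m : ℕ, m ≠ 0 → sampleConcurrenceProb X P' m
      = ∑ q ∈ Finset.range k, hittingProb ζ Y s P (q + 1) / (m : ℝ) ^ q :=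
    fun m hm => hη'.sampleConcurrenceProb_eq_sum hh hXm hXindep hXlaw hm
  have hsum : ∑ q ∈ Finset.range k, hittingProb ζ Y s P (q + 1) = 1 := hη'.sum_hittingProb
  have hnn : ∀ q, 0 ≤ hittingProb ζ Y s P q := fun q => measureReal_nonneg
  have hone : hittingProb ζ Y s P 1 = 0 :=
    le_antisymm (hη'.hittingProb_one_le.trans_eq hp) (hnn 1)
  -- The hitting probabilities sum to 1, so one is positive, and it is not that of a single
  -- component. Hence the set defining r is nonempty and `sInf` is a genuine minimum.
  obtain ⟨q, hqk, hq⟩ : ∃ q < k, 0 < hittingProb ζ Y s P (q + 1) := by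
    by_contra! hcon
    have := Finset.sum_nonpos fun q hq => hcon q (Finset.mem_range.1 hq)
    linarith
  have hq1 : 1 ≤ q := by
    rcases Nat.eq_zero_or_pos q with rfl | h0
    · rw [zero_add, hone] at hq
      exact absurd hq (lt_irrefl _)
    · exact h0
  have hmem : r ∈ {q : ℕ | 1 ≤ q ∧ 0 < hittingProb ζ Y s P (q + 1)} := by
    rw [hr]
    exact Nat.sInf_mem ⟨q, hq1, hq⟩
  have hrq : r ≤ q := by
    rw [hr]
    exact Nat.sInf_le ⟨hq1, hq⟩
  have hrk : r < k := lt_of_le_of_lt hrq hqk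
  have hcr : c = hittingProb ζ Y s P (r + 1) := by rw [hc, hr]; rfl
  have hcpos : 0 < c := hcr ▸ hmem.2
  have hlow : ∀ q < r, hittingProb ζ Y s P (q + 1) = 0 := by
    intro q hq
    rcases Nat.eq_zero_or_pos q with rfl | h0
    · exact hone
    · refine le_antisymm (not_lt.1 fun hpos => ?_) (hnn _)
      refine absurd (Nat.sInf_le (?_ : q ∈ {q : ℕ | 1 ≤ q ∧ 0 < hittingProb ζ Y s P (q + 1)}))
        (not_le.2 ?_)
      · exact ⟨h0, hpos⟩
      · rw [hr] at hq
        exact hq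
  have hlim : Tendsto (fun m : ℕ => (m : ℝ) ^ r * sampleConcurrenceProb X P' m) atTop (𝓝 c) := by
    rw [hcr]
    refine (tendsto_pow_mul_sum_div_pow (c := fun q => hittingProb ζ Y s P (q + 1)) hrk hlow).congr' ?_
    filter_upwards [eventually_ne_atTop 0] with m hm
    rw [hp_sum m hm]
  refine ⟨⟨hmem.1, by omega, hcpos, ?_, ?_⟩, fun m hm => ⟨fun lam hlam hml => ?_, fun hml => ?_⟩⟩
  · rw [hp, sub_zero, hcr]
    exact measureReal_le_one
  · rw [hp]
    simp only [sub_zero]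
    refine (Asymptotics.isEquivalent_iff_tendsto_one ?_).2 ?_
    · filter_upwards [eventually_gt_atTop 0] with m hm
      positivity
    · have h1 := hlim.div_const c
      rw [div_self hcpos.ne'] at h1
      refine h1.congr' ?_
      filter_upwards [eventually_gt_atTop 0] with m hm
      have : (m : ℝ) ≠ 0 := by positivity
      simp only [Pi.div_apply]
      field_simp
  -- In both cases m → ∞ because n^(1/(r+1)) → ∞ and the ratio of m to it has a positive or infinite
  -- limit; only then may the asymptotics of p_m be evaluated along m(n).
  all_goals
    have hroot : Tendsto (fun n : ℕ => (n : ℝ) ^ (1 / ((r : ℝ) + 1))) atTop atTop :=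
      (tendsto_rpow_atTop (by positivity)).comp tendsto_natCast_atTop_atTop
    have hmul : ∀ᶠ n : ℕ in atTop, (m n : ℝ) / (n : ℝ) ^ (1 / ((r : ℝ) + 1))
        * (n : ℝ) ^ (1 / ((r : ℝ) + 1)) = m n := by
      filter_upwards [hroot.eventually_gt_atTop 0] with n hn
      exact div_mul_cancel₀ _ hn.ne'
  · have hmtop : Tendsto m atTop atTop :=
      tendsto_natCast_atTop_iff.1 ((hml.pos_mul_atTop hlam hroot).congr' hmul)
    have hN := tendsto_div_mul_of_tendsto_pow_mul hlim hmtop (hml.inv₀ hlam.ne')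
    have hκ : c * lam⁻¹ ^ (r + 1) = c / lam ^ (r + 1) := by rw [inv_pow, div_eq_mul_inv]
    rw [hκ] at hN
    exact tendstoInDistribution_estimator hXm hXindep
      (fun i => (hXlaw i).map_eq) (by positivity) hm hN
  · have hmtop : Tendsto m atTop atTop :=
      tendsto_natCast_atTop_iff.1 ((hml.atTop_mul_atTop₀ hroot).congr' hmul)
    have hN := tendsto_div_mul_of_tendsto_pow_mul hlim hmtop hml.inv_tendsto_atTop
    rw [zero_pow (Nat.succ_ne_zero r), mul_zero] at hN
    exact ⟨tendsto_measureReal_estimator_eq_zero hXm hXindep (fun i => (hXlaw i).map_eq) hN,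
      fun a _ => tendstoInMeasure_mul_estimator hXm hXindep (fun i => (hXlaw i).map_eq) hN a⟩
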